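/- Let $d\ge 1$ and $n\ge 1$ be integers, let $\mu_*\in\mathbb R^{d\times d}$ be symmetric positive definite, let $X_1,\dots,X_n$ be independent random vectors with law $\mathcal N(0,\mu_*)$ on $\mathbb R^d$, and put $p=\frac{d(d+1)}2$ and $$\hat\mu_n=\frac1n\sum_{i=1}^n X_iX_i^\top .$$ Let $\mathrm{KL}(\mu_*\,\|\,\hat\mu_n)\in[0,\infty]$ denote the Kullback–Leibler divergence of $\mathcal N(0,\mu_*)$ from $\mathcal N(0,\hat\mu_n)$ (it is $+\infty$ when $\hat\mu_n$ is singular). Let $A^*(\mu)=\mathbb E_{X\sim\mathcal N(0,\mu)}[\log p_\mu(X)]$, where $p_\mu$ is the density of $\mathcal N(0,\mu)$, be the (negative differential) entropy as a function of the covariance $\mu$, and let $\mathcal B_{A^*}(\mu;\mu')=A^*(\mu)-A^*(\mu')-\langle\nabla A^*(\mu'),\mu-\mu'\rangle$ be its Bregman divergence. Then: 1. If $n\ge d$, then almost surely $\hat\mu_n$ is positive definite and is the unique maximum likelihood estimate of the covariance (the unique maximizer of $\mu\mapsto\prod_{i=1}^n p_\mu(X_i)$ over positive definite $\mu$), and $\mathrm{KL}(\mu_*\,\|\,\hat\mu_n)$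 is finite and equal to $\mathcal B_{A^*}(\mu_*;\hat\mu_n)$. 2. $\mathrm{KL}(\mu_*\,\|\,\hat\mu_n)$ is almost surely equal to a measurable function on the probability space, and if $n\le d+1$, then $\mathbb E[\mathrm{KL}(\mu_*\,\|\,\hat\mu_n)]=+\infty$. 3. If $n>d+1$, then this expectation is finite, $$\mathbb E\big[\mathrm{KL}(\mu_*\,\|\,\hat\mu_n)\big]=\frac{p}{n-d-1}+\frac12\Big(\psi_d\big(\tfrac n2\big)-d\log\tfrac n2\Big),\qquad \psi_d\big(\tfrac n2\big)=\sum_{i=0}^{d-1}\psi\big(\tfrac{n-i}2\big),$$ where $\psi=\Gamma'/\Gamma$ is the digamma function, and $$\mathbb E\big[\mathrm{KL}(\mu_*\,\|\,\hat\mu_n)\big]\le\frac{p}{2n}+\frac{p(d+2)}{n(n-d-1)} .$$ -/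

import Mathlib

open MeasureTheory ProbabilityTheory InformationTheory
open scoped ENNReal Matrix

noncomputable section

/-- Lebesgue density at `x` of the centred Gaussian on `ℝ^d` with positive definite covariance `S`:
`((2π)^d det S)^(-1/2) exp (-xᵀ S⁻¹ x / 2)`. -/
def gaussianCovDensity {d : ℕ} (S : Matrix (Fin d) (Fin d) ℝ)
    (x : EuclideanSpace ℝ (Fin d)) : ℝ :=
  (√((2 * Real.pi) ^ d * S.det))⁻¹ * Real.exp (-(x.ofLp ⬝ᵥ S⁻¹ *ᵥ x.ofLp) / 2)

/-- Likelihood of the covariance `S` for the sample `x₁, …, xₙ` in the model `N(0, S)`. -/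
def gaussianCovLikelihood {d n : ℕ} (x : Fin n → EuclideanSpace ℝ (Fin d))
    (S : Matrix (Fin d) (Fin d) ℝ) : ℝ :=
  ∏ i, gaussianCovDensity S (x i)

/-- `S` is a maximum likelihood estimate of the covariance: it is positive definite and maximizes
the likelihood among all positive definite matrices. -/
def IsGaussianCovMLE {d n : ℕ} (x : Fin n → EuclideanSpace ℝ (Fin d))
    (S : Matrix (Fin d) (Fin d) ℝ) : Prop :=
  S.PosDef ∧ ∀ S' : Matrix (Fin d) (Fin d) ℝ, S'.PosDef →
    gaussianCovLikelihood x S' ≤ gaussianCovLikelihood x S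

/-- The estimator `(1/n) ∑ᵢ xᵢ xᵢᵀ`, i.e. the empirical mean of the sufficient statistic `x xᵀ`. -/
def sampleCov {d n : ℕ} (x : Fin n → EuclideanSpace ℝ (Fin d)) : Matrix (Fin d) (Fin d) ℝ :=
  (n : ℝ)⁻¹ • ∑ i, Matrix.vecMulVec (x i).ofLp (x i).ofLp

/-- Kullback-Leibler divergence `KL(N(0, S) ‖ N(0, S'))`, with values in `[0, ∞]`; it is `∞` if
`S` is positive definite and `S'` is singular. -/
def gaussianCovKL {d : ℕ} (S S' : Matrix (Fin d) (Fin d) ℝ) : ℝ≥0∞ :=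
  klDiv (multivariateGaussian 0 S) (multivariateGaussian 0 S')

/-- The Bregman divergence `F x - F y - ⟨∇F(y), x - y⟩`; the last term is the derivative of `F`
at `y` in the direction `x - y`. -/
def bregmanDivergence {E : Type*} [AddCommGroup E] [Module ℝ E] (F : E → ℝ) (x y : E) : ℝ :=
  F x - F y - lineDeriv ℝ F y (x - y)

/-- The entropy `A*` of the family `N(0, S)` as a function of the mean parameter `S = E[X Xᵀ]`:
`A*(S) = ⟨S, θ⟩ - A(θ) = E[log p_S(X)]` for `X ∼ N(0, S)`. -/
def gaussianCovEntropy {d : ℕ} (S : Matrix (Fin d) (Fin d) ℝ) : ℝ :=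
  ∫ x, Real.log (gaussianCovDensity S x) ∂(multivariateGaussian 0 S)

/-- The multivariate digamma function `ψ_d(a) = ∑_{i=0}^{d-1} ψ(a - i/2)` at a real `a`. -/
def multivariateDigamma (d : ℕ) (a : ℝ) : ℝ :=
  ∑ i ∈ Finset.range d, (Complex.digamma ((a - (i : ℝ) / 2 : ℝ) : ℂ)).re

end

/-!
The divergence of `N(0, S)` from `N(0, M)` is Stein's loss
`(tr (M⁻¹ S) - d - log det S + log det M) / 2` when `M` is positive definite
(`gaussianCovKL_ne_top_and_toReal`), and `∞` when `M` is singular, since `N(0, M)` then lives on a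
hyperplane (`gaussianCovKL_eq_top`). Both follow from the density of `N(0, S)`. The entropy of
`N(0, S)` is an affine function of `log det S`, whose derivative in the direction `V` is
`tr (S⁻¹ V)`, so its Bregman divergence is the same expression. The log-likelihood at `S` falls
short of the one at the sample covariance `M` by `n` times the loss of `(M, S)`, so that the
positivity of the divergence makes `M` the unique maximizer as soon as it is positive definite.

For the expectation, `X_i = R Y_i` with `R` the square root of `S` and `Y_i` standard Gaussian.
The matrix with columns `Y_i` has `d` independent standard Gaussian rows `v_k` in `ℝⁿ`, and
`M = n⁻¹ R G R` with `G` the Gram matrix of the rows (`exists_measurePreserving_sampleCov`). Thus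
the loss of `(S, M)` is `(n tr G⁻¹ - d + log det G - d log n) / 2`, free of `S`.

The determinant of `G` is the squared distance from one row to the span of the other rows times
the Gram determinant of the other rows (`det_gram_eq_sq_norm_mul`). Given the other rows, the
first factor is the squared norm of a standard Gaussian vector in the orthogonal complement of
their span, hence a chi-squared variable with `n - d + 1` degrees of freedom, that is, a Gamma
variable (`measurePreserving_gramRatio`). This factor is also the inverse of the diagonal entry of
`G⁻¹` belonging to the chosen row. Three facts follow: `G` is almost surely invertible for
`d ≤ n`; the mean of `log det G` is a sum of digamma values, by peeling off one row at a time; and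
the mean of a diagonal entry of `G⁻¹` is `1 / (n - d - 1)`, or `∞` if `n` is `d` or `d + 1`. In
the latter case the logarithmic part of the loss cannot compensate the trace, because
`tr (M⁻¹ S) / 4 - d log 2 / 2` is a lower bound for the loss (`le_steinLoss`).

The final inequality is the bound `ψ x ≤ log x - 1 / (2 x)`, applied to each digamma value.
-/

section

open Real Module

section StdGaussian

/-! ### The standard Gaussian measure: density, projections, squared norm -/

variable {E : Type*} [NormedAddCommGroup E] [InnerProductSpace ℝ E] [FiniteDimensional ℝ E]
  [MeasurableSpace E] [BorelSpace E]

lemma integrable_exp_neg_half_sq_norm :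
    Integrable fun x : E => Real.exp (-‖x‖ ^ 2 / 2) := by
  have h := (GaussianFourier.integrable_cexp_neg_mul_sq_norm_add (V := E) (b := (1 / 2 : ℂ))
    (by norm_num) 0 0).norm
  refine h.congr (ae_of_all _ fun x => ?_)
  simp only [Complex.norm_exp]
  norm_num [← Complex.ofReal_pow]
  ring_nf

lemma stdGaussian_eq_withDensity :
    stdGaussian E = volume.withDensity fun x =>
      ENNReal.ofReal ((√((2 * π) ^ finrank ℝ E))⁻¹ * Real.exp (-‖x‖ ^ 2 / 2)) := by
  have hint := (integrable_exp_neg_half_sq_norm (E := E)).const_mul (√((2 * π) ^ finrank ℝ E))⁻¹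
  have := isFiniteMeasure_withDensity_ofReal hint.2
  -- Both sides are finite measures with characteristic function `exp (-‖t‖ ^ 2 / 2)`.
  refine Measure.ext_of_charFun (funext fun t => ?_)
  rw [charFun_stdGaussian, charFun_apply, integral_withDensity_eq_integral_toReal_smul
    (by fun_prop) (ae_of_all _ fun x => ENNReal.ofReal_lt_top)]
  have h := GaussianFourier.integral_cexp_neg_mul_sq_norm_add (V := E) (b := (1 / 2 : ℂ))
    (by norm_num) Complex.I t
  have hpos : 0 < 2 * π := by positivity
  have hc : (√((2 * π) ^ finrank ℝ E) : ℂ) = (π / (1 / 2 : ℂ)) ^ (finrank ℝ E / 2 : ℂ) := by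
    have : (π / (1 / 2 : ℂ)) = ((2 * π : ℝ) : ℂ) := by push_cast; ring
    rw [this, show (finrank ℝ E / 2 : ℂ) = ((finrank ℝ E / 2 : ℝ) : ℂ) by push_cast; rfl,
      ← Complex.ofReal_cpow hpos.le, Real.sqrt_eq_rpow, ← Real.rpow_natCast,
      ← Real.rpow_mul hpos.le]
    congr 2; ring
  have hne : (√((2 * π) ^ finrank ℝ E) : ℂ) ≠ 0 := by
    rw [Complex.ofReal_ne_zero]; positivity
  have hfun : ∀ x : E,
      (ENNReal.ofReal ((√((2 * π) ^ finrank ℝ E))⁻¹ * Real.exp (-‖x‖ ^ 2 / 2))).toReal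
      • Complex.exp (inner ℝ x t * Complex.I) =
      (√((2 * π) ^ finrank ℝ E) : ℂ)⁻¹ *
        Complex.exp (-(1 / 2 : ℂ) * ‖x‖ ^ 2 + Complex.I * inner ℝ t x) := by
    intro x
    rw [ENNReal.toReal_ofReal (by positivity), Complex.real_smul, Complex.ofReal_mul,
      Complex.ofReal_exp, Complex.ofReal_inv, mul_assoc, ← Complex.exp_add, real_inner_comm x t]
    congr 2; push_cast; ring
  simp_rw [hfun]
  rw [integral_const_mul, h, ← hc, inv_mul_cancel_left₀ hne]
  congr 1
  rw [Complex.I_sq]; ring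

/-- The orthogonal projection of a standard Gaussian vector onto a subspace is standard Gaussian
there. -/
lemma stdGaussian_map_orthogonalProjectionOnto (V : Submodule ℝ E) :
    (stdGaussian E).map V.orthogonalProjectionOnto = stdGaussian V := by
  have := Measure.isProbabilityMeasure_map (μ := stdGaussian E)
    (f := V.orthogonalProjectionOnto) (by fun_prop)
  refine Measure.ext_of_charFun (funext fun t => ?_)
  rw [charFun_stdGaussian, charFun_apply, integral_map (by fun_prop) (by fun_prop)]
  have : ∀ x : E, inner ℝ (V.orthogonalProjectionOnto x) t = inner ℝ x (t : E) := fun x =>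
    Submodule.inner_orthogonalProjectionOnto_eq_of_mem_right t x
  simp_rw [this]
  rw [← charFun_apply, charFun_stdGaussian]; rfl

/-- The squared norm of a standard Gaussian vector has the chi-squared distribution. -/
lemma stdGaussian_map_sq_norm (h : 0 < finrank ℝ E) :
    (stdGaussian E).map (fun x => ‖x‖ ^ 2) = gammaMeasure (finrank ℝ E / 2) (1 / 2) := by
  set k := finrank ℝ E with hk
  have hkpos : (0 : ℝ) < k := by exact_mod_cast h
  have : Nontrivial E := Module.finrank_pos_iff.mp h
  have hp := Measure.isProbabilityMeasure_map (μ := stdGaussian E)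
    (f := fun x => ‖x‖ ^ 2) (by fun_prop)
  have hg : IsProbabilityMeasure (gammaMeasure (k / 2) (1 / 2)) :=
    isProbabilityMeasure_gammaMeasure (by positivity) (by norm_num)
  -- In polar coordinates both measures have densities that agree up to a constant.
  obtain ⟨C, hC⟩ : ∃ C : ℝ, ∀ A : Set ℝ, MeasurableSet A →
      ((stdGaussian E).map (fun x => ‖x‖ ^ 2)).real A =
        C * (gammaMeasure (k / 2) (1 / 2)).real A := by
    let D : ℝ := (1 / 2) ^ ((k : ℝ) / 2) / Gamma (k / 2)
    have hD : 0 < D := by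
      have := Gamma_pos_of_pos (show 0 < (k : ℝ) / 2 by positivity)
      positivity
    refine ⟨(√((2 * π) ^ k))⁻¹ * (k * (volume.real (Metric.ball (0 : E) 1))) * (1 / 2) * D⁻¹,
      fun A hA => ?_⟩
    let f : ℝ → ℝ := fun t =>
      A.indicator (fun t => t ^ ((k : ℝ) / 2 - 1) * Real.exp (-(1 / 2 * t))) t
    have h1 : (gammaMeasure (k / 2) (1 / 2)).real A = D * ∫ t in Set.Ioi 0, f t := by
      rw [measureReal_def, gammaMeasure, withDensity_apply _ hA, ← lintegral_indicator hA]
      have : ∀ x, A.indicator (gammaPDF (k / 2) (1 / 2)) x =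
          ENNReal.ofReal (A.indicator (gammaPDFReal (k / 2) (1 / 2)) x) := by
        intro x; by_cases hx : x ∈ A <;> simp [hx, gammaPDF]
      simp_rw [this]
      rw [← integral_eq_lintegral_of_nonneg_ae, ← integral_const_mul,
        ← integral_indicator measurableSet_Ioi]
      · refine integral_congr_ae ?_
        filter_upwards [Measure.ae_ne volume 0] with x hx
        rcases lt_or_gt_of_ne hx with hx | hx
        · by_cases hxA : x ∈ A <;> simp [hxA, gammaPDFReal, hx.not_ge, hx.le]
        · by_cases hxA : x ∈ A <;> simp [hxA, gammaPDFReal, hx, hx.le, f, D]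
          ring
      · exact ae_of_all _ fun x => Set.indicator_nonneg
          (fun y _ => gammaPDFReal_nonneg (by positivity) (by norm_num) y) x
      · exact ((measurable_gammaPDFReal _ _).indicator hA).aestronglyMeasurable
    have h2 : ((stdGaussian E).map (fun x => ‖x‖ ^ 2)).real A =
        ∫ x : E, (√((2 * π) ^ k))⁻¹ * A.indicator (fun t => Real.exp (-(1 / 2 * t))) (‖x‖ ^ 2) := by
      rw [measureReal_def, Measure.map_apply (by fun_prop) hA, stdGaussian_eq_withDensity,
        withDensity_apply _ (hA.preimage (by fun_prop)),
        ← lintegral_indicator (hA.preimage (by fun_prop))]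
      rw [integral_eq_lintegral_of_nonneg_ae]
      · congr 1
        refine lintegral_congr fun x => ?_
        by_cases hx : ‖x‖ ^ 2 ∈ A
        · simp only [Set.indicator, Set.mem_preimage, hx, if_true, ← hk]
          congr 3; ring
        · simp [hx]
      · exact ae_of_all _ fun x => mul_nonneg (by positivity)
          (Set.indicator_nonneg (fun y _ => by positivity) _)
      · refine Measurable.aestronglyMeasurable (Measurable.const_mul ?_ _)
        exact Measurable.comp (g := A.indicator (fun t => Real.exp (-(1 / 2 * t))))
          (Measurable.indicator (by fun_prop) hA) (by fun_prop)
    have h3 := integral_fun_norm_addHaar (E := E) volume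
      (fun r => A.indicator (fun t => Real.exp (-(1 / 2 * t))) (r ^ 2))
    have h4 := integral_comp_rpow_Ioi_of_pos (g := f) (p := 2) (by norm_num)
    have h5 : ∫ y in Set.Ioi (0 : ℝ), y ^ (k - 1) •
        A.indicator (fun t => Real.exp (-(1 / 2 * t))) (y ^ 2) =
        (1 / 2) * ∫ t in Set.Ioi 0, f t := by
      rw [← h4, ← integral_const_mul]
      refine setIntegral_congr_fun measurableSet_Ioi fun y hy => ?_
      have hy : 0 < y := hy
      have h6 : y ^ (k - 1) = y * (y ^ 2) ^ ((k : ℝ) / 2 - 1) := by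
        rw [← Real.rpow_natCast y 2, ← Real.rpow_mul hy.le, ← Real.rpow_natCast,
          Nat.cast_sub h]
        nth_rewrite 2 [← Real.rpow_one y]
        rw [← Real.rpow_add hy]
        congr 1; push_cast; ring
      simp only [smul_eq_mul, f, Real.rpow_ofNat]
      rw [show (2 : ℝ) - 1 = 1 by norm_num, Real.rpow_one]
      by_cases hyA : y ^ 2 ∈ A
      · simp only [Set.indicator, hyA, if_true, h6]; ring
      · simp [hyA]
    rw [h2, integral_const_mul, h3, h1, ← hk, h5]
    simp only [nsmul_eq_mul, smul_eq_mul]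
    field_simp
  -- Comparing total masses determines the constant.
  have hC1 : C = 1 := by
    have := hC Set.univ MeasurableSet.univ
    rw [probReal_univ, probReal_univ, mul_one] at this
    exact this.symm
  refine Measure.ext fun A hA => ?_
  have := hC A hA
  rw [hC1, one_mul, measureReal_def, measureReal_def] at this
  exact (ENNReal.toReal_eq_toReal_iff' (measure_ne_top _ _) (measure_ne_top _ _)).mp this

end StdGaussian

section Digamma

/-! ### The digamma function on the positive reals -/

lemma ofReal_ne_neg_natCast {x : ℝ} (hx : 0 < x) (m : ℕ) : (x : ℂ) ≠ -m := by
  intro h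
  have := congrArg Complex.re h
  simp at this
  have hm : (0 : ℝ) ≤ m := m.cast_nonneg
  linarith

lemma hasDerivAt_log_Gamma {x : ℝ} (hx : 0 < x) :
    HasDerivAt (Real.log ∘ Real.Gamma) (Complex.digamma x).re x := by
  have h := (Complex.differentiableAt_Gamma (x : ℂ)
    (ofReal_ne_neg_natCast hx)).hasDerivAt.real_of_complex
  simp only [Complex.Gamma_ofReal, Complex.ofReal_re] at h
  have h2 := h.log (Real.Gamma_pos_of_pos hx).ne'
  convert! h2 using 1
  rw [Complex.digamma_def, logDeriv_apply, Complex.Gamma_ofReal, Complex.div_ofReal_re]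

lemma digamma_re_add_one {x : ℝ} (hx : 0 < x) :
    (Complex.digamma (x + 1 : ℝ)).re = (Complex.digamma x).re + x⁻¹ := by
  rw [Complex.ofReal_add, Complex.ofReal_one,
    Complex.digamma_apply_add_one _ (ofReal_ne_neg_natCast hx), Complex.add_re,
    ← Complex.ofReal_inv, Complex.ofReal_re]

/-- Convexity of `log Γ` bounds its derivative at `x` by the slope over `[x, x + 1]`. -/
lemma digamma_re_le_log {x : ℝ} (hx : 0 < x) : (Complex.digamma x).re ≤ log x := by
  have h := Real.convexOn_log_Gamma.le_slope_of_hasDerivAt (x := x) (y := x + 1) hx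
    (show 0 < x + 1 by linarith) (by linarith) (hasDerivAt_log_Gamma hx)
  have := Real.Gamma_pos_of_pos hx
  simpa [slope_def_field, Real.Gamma_add_one hx.ne', Real.log_mul hx.ne' this.ne'] using h

/-- The defect `log x - 1 / (2 x) - ψ x` decreases along `x ↦ x + 1` by the trapezoidal bound for
`∫ 1 / t`, and it is asymptotically nonnegative. -/
lemma digamma_re_le_log_sub {x : ℝ} (hx : 0 < x) :
    (Complex.digamma x).re ≤ log x - 1 / (2 * x) := by
  let g : ℝ → ℝ := fun x => log x - 1 / (2 * x) - (Complex.digamma x).re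
  have hstep : ∀ y, 0 < y → g (y + 1) ≤ g y := by
    intro y hy
    -- `log s ≤ sinh (log s) = (s - s⁻¹) / 2` for `s ≥ 1`, applied to `s = (y + 1) / y`.
    have h1 : log ((y + 1) / y) ≤ ((y + 1) / y - ((y + 1) / y)⁻¹) / 2 := by
      rw [← Real.sinh_log (by positivity), Real.self_le_sinh_iff]
      exact Real.log_nonneg (by rw [le_div_iff₀ hy]; linarith)
    rw [Real.log_div (by positivity) (by positivity)] at h1
    have h2 : ((y + 1) / y - ((y + 1) / y)⁻¹) / 2 = y⁻¹ - 1 / (2 * y) + 1 / (2 * (y + 1)) := by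
      field_simp; ring
    simp only [g, digamma_re_add_one hy]
    linarith
  have hle : ∀ m : ℕ, g (x + m) ≤ g x := by
    intro m
    induction m with
    | zero => simp
    | succ m ih =>
      have := hstep (x + m) (by positivity)
      push_cast
      rw [← add_assoc]
      exact this.trans ih
  have hlow : ∀ m : ℕ, -(1 / (2 * (x + m))) ≤ g x := by
    intro m
    refine le_trans ?_ (hle m)
    have := digamma_re_le_log (x := x + m) (by positivity)
    simp only [g]
    linarith
  have hlim : Filter.Tendsto (fun m : ℕ => -(1 / (2 * (x + m)))) Filter.atTop (nhds 0) := by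
    have h1 : Filter.Tendsto (fun m : ℕ => 2 * (x + m)) Filter.atTop Filter.atTop :=
      (Filter.tendsto_atTop_add_const_left _ x tendsto_natCast_atTop_atTop).const_mul_atTop
        two_pos
    simpa using h1.inv_tendsto_atTop.neg
  have := le_of_tendsto' hlim hlow
  simp only [g] at this
  linarith

end Digamma

section GammaMoments

/-! ### Logarithmic and inverse moments of Gamma distributions -/

variable {a r : ℝ}

/-- Differentiating the Mellin transform `s ↦ Γ(s) / r ^ s` of `exp (-r t)` under the integral
sign. -/
lemma integrableOn_and_integral_rpow_mul_log_mul_exp (ha : 0 < a) (hr : 0 < r) :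
    IntegrableOn (fun t : ℝ => t ^ (a - 1) * (log t * Real.exp (-(r * t)))) (Set.Ioi 0) ∧
    ∫ t in Set.Ioi 0, t ^ (a - 1) * (log t * Real.exp (-(r * t))) =
      Real.Gamma a / r ^ a * ((Complex.digamma a).re - log r) := by
  have hcont : Continuous fun t : ℝ => ((Real.exp (-(r * t)) : ℝ) : ℂ) := by fun_prop
  obtain ⟨hconv, hder⟩ := mellin_hasDerivAt_of_isBigO_rpow (E := ℂ) (s := (a : ℂ)) (a := a + 1)
    (b := 0) (f := fun t : ℝ => ((Real.exp (-(r * t)) : ℝ) : ℂ))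
    (hcont.continuousOn.locallyIntegrableOn measurableSet_Ioi)
    (by
      rw [← Asymptotics.isBigO_norm_left]
      simp_rw [Complex.norm_real, Asymptotics.isBigO_norm_left]
      simpa only [neg_mul] using (isLittleO_exp_neg_mul_rpow_atTop hr _).isBigO)
    (by simp)
    (by
      simp_rw [neg_zero, Real.rpow_zero]
      refine Asymptotics.isBigO_const_of_tendsto (y := ((Real.exp (-(r * 0)) : ℝ) : ℂ)) ?_
        one_ne_zero
      exact (hcont.tendsto 0).mono_left nhdsWithin_le_nhds)
    (by simpa using ha)
  have hreal : ∀ t ∈ Set.Ioi (0 : ℝ), (t : ℂ) ^ ((a : ℂ) - 1) •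
      (log t • ((Real.exp (-(r * t)) : ℝ) : ℂ)) =
      ((t ^ (a - 1) * (log t * Real.exp (-(r * t))) : ℝ) : ℂ) := by
    intro t ht
    rw [Complex.ofReal_mul, Complex.ofReal_cpow (le_of_lt ht)]
    push_cast
    simp [Complex.real_smul]
  have hconv' := (integrableOn_congr_fun hreal measurableSet_Ioi).mp hconv
  refine ⟨?_, ?_⟩
  · have := hconv'.re
    simp only [RCLike.re_to_complex, Complex.ofReal_re] at this
    exact this
  have hr0 : (1 / r : ℂ) ≠ 0 := by simp [hr.ne']
  have hmel : mellin (fun t : ℝ => ((Real.exp (-(r * t)) : ℝ) : ℂ)) =ᶠ[nhds (a : ℂ)]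
      fun s => (1 / r : ℂ) ^ s * Complex.Gamma s := by
    have : IsOpen {s : ℂ | 0 < s.re} := isOpen_lt continuous_const Complex.continuous_re
    filter_upwards [this.mem_nhds (show 0 < (a : ℂ).re by simpa using ha)] with s hs
    rw [← Complex.integral_cpow_mul_exp_neg_mul_Ioi hs (r := r) (by simpa using hr), mellin]
    refine setIntegral_congr_fun measurableSet_Ioi fun t _ => ?_
    simp
  have hder2 := ((hasDerivAt_id (a : ℂ)).const_cpow (c := (1 / r : ℂ)) (Or.inl hr0)).mul
    (Complex.differentiableAt_Gamma (a : ℂ) (ofReal_ne_neg_natCast ha)).hasDerivAt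
  have heq := (hder.congr_of_eventuallyEq hmel.symm).unique hder2
  rw [mellin, setIntegral_congr_fun measurableSet_Ioi hreal, integral_complex_ofReal] at heq
  have hG := Real.Gamma_pos_of_pos ha
  have hdig : deriv Complex.Gamma a = Complex.digamma a * Complex.Gamma a := by
    rw [Complex.digamma_def, logDeriv_apply, div_mul_cancel₀]
    rw [Complex.Gamma_ofReal]; exact_mod_cast hG.ne'
  have hpow : (1 / r : ℂ) ^ (a : ℂ) = (((r ^ a)⁻¹ : ℝ) : ℂ) := by
    rw [← Real.inv_rpow hr.le, Complex.ofReal_cpow (by positivity)]; simp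
  have hlog : Complex.log (1 / r : ℂ) = ((-log r : ℝ) : ℂ) := by
    rw [← Real.log_inv, Complex.ofReal_log (by positivity)]; simp
  have := congrArg Complex.re heq
  simp only [id] at this
  rw [hdig, hlog, hpow, Complex.Gamma_ofReal] at this
  rw [Complex.ofReal_re] at this
  rw [this]
  simp only [mul_one, Complex.add_re, Complex.re_ofReal_mul, Complex.re_mul_ofReal,
    Complex.ofReal_re]
  field_simp
  ring

lemma integrable_and_integral_log_gammaMeasure (ha : 0 < a) (hr : 0 < r) :
    Integrable log (gammaMeasure a r) ∧
    ∫ x, log x ∂(gammaMeasure a r) = (Complex.digamma a).re - log r := by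
  obtain ⟨h1, h2⟩ := integrableOn_and_integral_rpow_mul_log_mul_exp ha hr
  have hG := Real.Gamma_pos_of_pos ha
  have hpdf : ∀ x, (gammaPDF a r x).toReal = gammaPDFReal a r x := fun x =>
    ENNReal.toReal_ofReal (gammaPDFReal_nonneg ha hr x)
  have hmeas : Measurable (gammaPDF a r) := (measurable_gammaPDFReal a r).ennreal_ofReal
  have htop : ∀ᵐ x, gammaPDF a r x < ∞ := ae_of_all _ fun x => ENNReal.ofReal_lt_top
  have hae : (fun x => (gammaPDF a r x).toReal • log x) =ᵐ[volume]
      (Set.Ioi 0).indicator fun t => r ^ a / Real.Gamma a *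
        (t ^ (a - 1) * (log t * Real.exp (-(r * t)))) := by
    filter_upwards [Measure.ae_ne volume 0] with x hx
    rw [hpdf]
    rcases lt_or_gt_of_ne hx with hx | hx
    · simp [gammaPDFReal, hx.not_ge, hx.le]
    · simp [gammaPDFReal, hx.le, hx]; ring
  constructor
  · rw [gammaMeasure, integrable_withDensity_iff_integrable_smul' hmeas htop]
    rw [integrable_congr hae, integrable_indicator_iff measurableSet_Ioi]
    exact h1.const_mul _
  · rw [gammaMeasure, integral_withDensity_eq_integral_toReal_smul hmeas htop,
      integral_congr_ae hae, integral_indicator measurableSet_Ioi, integral_const_mul, h2]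
    have : 0 < r ^ a := Real.rpow_pos_of_pos hr a
    field_simp

/-- The weight `1 / x` turns the density with shape `a` into a multiple of the one with shape
`a - 1`. -/
lemma lintegral_inv_gammaMeasure (ha : 1 < a) (hr : 0 < r) :
    ∫⁻ x, ENNReal.ofReal x⁻¹ ∂(gammaMeasure a r) = ENNReal.ofReal (r / (a - 1)) := by
  have ha1 : 0 < a - 1 := by linarith
  have hmeas : Measurable (gammaPDF a r) := (measurable_gammaPDFReal a r).ennreal_ofReal
  rw [gammaMeasure, lintegral_withDensity_eq_lintegral_mul _ hmeas (by fun_prop)]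
  have : ∀ᵐ x, (gammaPDF a r * fun x => ENNReal.ofReal x⁻¹) x =
      ENNReal.ofReal (r / (a - 1)) * gammaPDF (a - 1) r x := by
    filter_upwards [Measure.ae_ne volume 0] with x hx
    rcases lt_or_gt_of_ne hx with hx | hx
    · simp [gammaPDF_of_neg hx]
    · rw [Pi.mul_apply, gammaPDF_of_nonneg hx.le, gammaPDF_of_nonneg hx.le,
        ← ENNReal.ofReal_mul (by positivity), ← ENNReal.ofReal_mul (by positivity)]
      have hG : Real.Gamma a = (a - 1) * Real.Gamma (a - 1) := by
        rw [← Real.Gamma_add_one ha1.ne', sub_add_cancel]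
      have hG1 := Real.Gamma_pos_of_pos ha1
      rw [hG, Real.rpow_sub_one hx.ne' (a - 1), Real.rpow_sub_one hr.ne' a]
      congr 1
      field_simp
  rw [lintegral_congr_ae this, lintegral_const_mul' _ _ ENNReal.ofReal_ne_top,
    lintegral_gammaPDF_eq_one ha1 hr, mul_one]

/-- Near the origin the integrand behaves like `t ^ (a - 2)`, which is not integrable. -/
lemma lintegral_inv_gammaMeasure_eq_top (ha : 0 < a) (ha1 : a ≤ 1) (hr : 0 < r) :
    ∫⁻ x, ENNReal.ofReal x⁻¹ ∂(gammaMeasure a r) = ∞ := by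
  have hmeas : Measurable (gammaPDF a r) := (measurable_gammaPDFReal a r).ennreal_ofReal
  rw [gammaMeasure, lintegral_withDensity_eq_lintegral_mul _ hmeas (by fun_prop)]
  by_contra hne
  have hG := Real.Gamma_pos_of_pos ha
  let D : ℝ := r ^ a / Real.Gamma a * Real.exp (-r)
  have hD : 0 < D := by positivity
  have hle : ∫⁻ x in Set.Ioo (0 : ℝ) 1, ENNReal.ofReal (D * x ^ (a - 2)) ≤
      ∫⁻ x, (gammaPDF a r * fun x => ENNReal.ofReal x⁻¹) x := by
    refine le_trans (setLIntegral_mono' measurableSet_Ioo fun x hx => ?_)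
      (setLIntegral_le_lintegral (Set.Ioo 0 1) _)
    have hx0 : 0 < x := hx.1
    rw [Pi.mul_apply, gammaPDF_of_nonneg hx0.le, ← ENNReal.ofReal_mul (by positivity)]
    refine ENNReal.ofReal_le_ofReal ?_
    have h1 : x ^ (a - 2) = x ^ (a - 1) * x⁻¹ := by
      rw [← Real.rpow_neg_one x, ← Real.rpow_add hx0]; congr 1; ring
    have h2 : Real.exp (-r) ≤ Real.exp (-(r * x)) := by
      refine Real.exp_le_exp.mpr ?_
      nlinarith [hx.2]
    calc D * x ^ (a - 2) = r ^ a / Real.Gamma a * x ^ (a - 1) * Real.exp (-r) * x⁻¹ := by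
          rw [h1]; ring
      _ ≤ _ := by gcongr
  have hint : IntegrableOn (fun x : ℝ => D * x ^ (a - 2)) (Set.Ioo 0 1) := by
    refine ⟨by fun_prop, ?_⟩
    rw [hasFiniteIntegral_iff_ofReal]
    · exact lt_of_le_of_lt hle (lt_top_iff_ne_top.mpr hne)
    · filter_upwards [ae_restrict_mem measurableSet_Ioo] with x hx
      have : 0 < x := hx.1
      simp only [Pi.zero_apply]
      positivity
  have hint2 : IntegrableOn (fun x : ℝ => x ^ (a - 2)) (Set.Ioo 0 1) := by
    refine (hint.const_mul D⁻¹).congr (ae_of_all _ fun x => ?_)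
    simp [hD.ne']
  rw [intervalIntegral.integrableOn_Ioo_rpow_iff one_pos] at hint2
  linarith

end GammaMoments

section GramDeterminant

/-! ### Gram determinants and orthogonal projections -/

variable {E : Type*} [NormedAddCommGroup E] [InnerProductSpace ℝ E]

lemma submatrix_gram_succAbove {m : ℕ} (v : Fin (m + 1) → E) (k : Fin (m + 1)) :
    (Matrix.gram ℝ v).submatrix k.succAbove k.succAbove = Matrix.gram ℝ (v ∘ k.succAbove) := rfl

lemma adjugate_gram_apply_self {m : ℕ} (v : Fin (m + 1) → E) (k : Fin (m + 1)) :
    (Matrix.gram ℝ v).adjugate k k = (Matrix.gram ℝ (v ∘ k.succAbove)).det := by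
  rw [Matrix.adjugate_fin_succ_eq_det_submatrix, submatrix_gram_succAbove, ← two_mul, pow_mul]
  simp

/-- The vector `∑ j, adj(G) k j • v j`, with `G` the Gram matrix of `v`, has inner product
`δᵢₖ det G` with `v i`; hence it is a multiple of the component of `v k` orthogonal to the other
vectors. -/
lemma det_gram_eq_sq_norm_mul [FiniteDimensional ℝ E] {m : ℕ} (v : Fin (m + 1) → E)
    (k : Fin (m + 1)) :
    (Matrix.gram ℝ v).det =
      ‖(Submodule.span ℝ (Set.range (v ∘ k.succAbove)))ᗮ.orthogonalProjectionOnto (v k)‖ ^ 2 *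
        (Matrix.gram ℝ (v ∘ k.succAbove)).det := by
  set V := Submodule.span ℝ (Set.range (v ∘ k.succAbove)) with hV
  let x : E := ∑ j, (Matrix.gram ℝ v).adjugate k j • v j
  have hinner : ∀ i, inner ℝ x (v i) = if k = i then (Matrix.gram ℝ v).det else 0 := by
    intro i
    have := congrFun (congrFun (Matrix.adjugate_mul (Matrix.gram ℝ v)) k) i
    rw [Matrix.mul_apply] at this
    simp only [x, sum_inner, real_inner_smul_left]
    simpa [Matrix.gram_apply, Matrix.one_apply] using this
  have hx : x ∈ Vᗮ := by
    rw [hV, Submodule.mem_orthogonal']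
    intro u hu
    induction hu using Submodule.span_induction with
    | mem u hu =>
      obtain ⟨j, rfl⟩ := hu
      simp [hinner, (Fin.succAbove_ne k j).symm]
    | zero => simp
    | add a b _ _ ha hb => rw [inner_add_right, ha, hb, add_zero]
    | smul c a _ ha => rw [inner_smul_right, ha, mul_zero]
  have hproj : (⟨x, hx⟩ : Vᗮ) =
      (Matrix.gram ℝ (v ∘ k.succAbove)).det • Vᗮ.orthogonalProjectionOnto (v k) := by
    rw [← Submodule.orthogonalProjectionOnto_mem_subspace_eq_self (K := Vᗮ) ⟨x, hx⟩]
    change Vᗮ.orthogonalProjectionOnto x = _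
    simp only [x]
    rw [Fin.sum_univ_succAbove _ k, adjugate_gram_apply_self, map_add, map_smul, map_sum]
    rw [Finset.sum_eq_zero, add_zero]
    intro j _
    rw [map_smul, Submodule.orthogonalProjectionOnto_orthogonal_apply_eq_zero,
      smul_zero]
    exact Submodule.subset_span ⟨j, rfl⟩
  have h1 : inner ℝ (⟨x, hx⟩ : Vᗮ) (Vᗮ.orthogonalProjectionOnto (v k)) =
      (Matrix.gram ℝ v).det := by
    rw [Submodule.inner_orthogonalProjectionOnto_eq_of_mem_left]
    simp [hinner]
  rw [← h1, hproj, real_inner_smul_left, real_inner_self_eq_norm_sq, mul_comm]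

/-- The factor `det G(v) / det G(v without v k)` contributed by `v k` to the Gram determinant of
`v`. If the other vectors are linearly independent, it is the squared distance from `v k` to their
span. -/
noncomputable def gramRatio {m : ℕ} (k : Fin (m + 1)) (v : Fin (m + 1) → E) : ℝ :=
  (Matrix.gram ℝ v).det / (Matrix.gram ℝ (v ∘ k.succAbove)).det

lemma inv_gram_apply_self {m : ℕ} (v : Fin (m + 1) → E) (k : Fin (m + 1)) :
    (Matrix.gram ℝ v)⁻¹ k k = (gramRatio k v)⁻¹ := by
  rw [gramRatio, Matrix.inv_def, Matrix.smul_apply, adjugate_gram_apply_self, Ring.inverse_eq_inv',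
    smul_eq_mul, inv_div, div_eq_inv_mul]

lemma continuous_gram {ι : Type*} : Continuous fun v : ι → E => Matrix.gram ℝ v := by
  refine continuous_matrix fun i j => ?_
  simp only [Matrix.gram_apply]
  fun_prop

end GramDeterminant

section GaussianGram

/-! ### Gram matrices of independent standard Gaussian vectors -/

variable {E : Type*} [NormedAddCommGroup E] [InnerProductSpace ℝ E] [FiniteDimensional ℝ E]
  [MeasurableSpace E] [BorelSpace E]

lemma measurable_det_gram {m : ℕ} : Measurable fun v : Fin m → E => (Matrix.gram ℝ v).det :=
  (continuous_gram.matrix_det).measurable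

lemma measurable_gramRatio {m : ℕ} (k : Fin (m + 1)) : Measurable (gramRatio (E := E) k) :=
  measurable_det_gram.div (measurable_det_gram.comp (by fun_prop))

/-- Conditionally on the other vectors, the ratio of Gram determinants is the squared norm of the
projection of one Gaussian vector onto a subspace of codimension `m`. -/
lemma measurePreserving_gramRatio_of_ae {m : ℕ} (hm : m < finrank ℝ E) (k : Fin (m + 1))
    (hae : ∀ᵐ v ∂(Measure.pi fun _ : Fin m => stdGaussian E), (Matrix.gram ℝ v).det ≠ 0) :
    MeasurePreserving (gramRatio (E := E) k)
      (Measure.pi fun _ : Fin (m + 1) => stdGaussian E)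
      (gammaMeasure (((finrank ℝ E : ℝ) - m) / 2) (1 / 2)) := by
  have hmeas := measurable_gramRatio (E := E) k
  refine ⟨hmeas, ?_⟩
  have hsplit := (measurePreserving_piFinSuccAbove (fun _ : Fin (m + 1) => stdGaussian E) k).symm
  rw [← hsplit.map_eq, Measure.map_map hmeas hsplit.measurable]
  refine Measure.ext fun A hA => ?_
  have hmeas2 := hmeas.comp hsplit.measurable
  rw [Measure.map_apply hmeas2 hA, Measure.prod_apply_symm (hmeas2 hA)]
  have hfib : ∀ᵐ w ∂(Measure.pi fun _ : Fin m => stdGaussian E),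
      stdGaussian E ((fun g => (g, w)) ⁻¹' ((gramRatio k ∘
        (MeasurableEquiv.piFinSuccAbove (fun _ => E) k).symm) ⁻¹' A)) =
      gammaMeasure (((finrank ℝ E : ℝ) - m) / 2) (1 / 2) A := by
    filter_upwards [hae] with w hw
    set V := Submodule.span ℝ (Set.range w) with hV
    have hli : LinearIndependent ℝ w := Matrix.linearIndependent_of_det_gram_ne_zero hw
    have hdim : finrank ℝ Vᗮ = finrank ℝ E - m := by
      have h1 := Submodule.finrank_add_finrank_orthogonal V
      have h2 : finrank ℝ V = m := by simpa using finrank_span_eq_card hli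
      omega
    have hfun : ∀ g : E, (gramRatio k ∘
        (MeasurableEquiv.piFinSuccAbove (fun _ => E) k).symm) (g, w) =
        ‖Vᗮ.orthogonalProjectionOnto g‖ ^ 2 := by
      intro g
      set v := (MeasurableEquiv.piFinSuccAbove (fun _ => E) k).symm (g, w) with hv
      have h1 : v k = g := by simp [hv]
      have h2 : v ∘ k.succAbove = w := by ext j; simp [hv]
      have h3 := det_gram_eq_sq_norm_mul v k
      rw [h1, h2] at h3
      simp only [Function.comp_apply, ← hv]
      rw [gramRatio, h2, h3, mul_div_assoc, div_self hw, mul_one]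
    have hset : (fun g => (g, w)) ⁻¹' ((gramRatio k ∘
        (MeasurableEquiv.piFinSuccAbove (fun _ => E) k).symm) ⁻¹' A) =
        Vᗮ.orthogonalProjectionOnto ⁻¹' ((fun x : Vᗮ => ‖x‖ ^ 2) ⁻¹' A) := by
      ext g
      simp only [Set.mem_preimage]
      rw [hfun]
    have hA2 : MeasurableSet ((fun x : Vᗮ => ‖x‖ ^ 2) ⁻¹' A) :=
      hA.preimage (by fun_prop)
    rw [hset, ← Measure.map_apply (by fun_prop) hA2, stdGaussian_map_orthogonalProjectionOnto,
      ← Measure.map_apply (by fun_prop) hA, stdGaussian_map_sq_norm (by omega), hdim,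
      Nat.cast_sub hm.le]
  rw [lintegral_congr_ae hfib]
  simp

lemma gammaMeasure_ae_ne_zero (a r : ℝ) : ∀ᵐ x ∂(gammaMeasure a r), x ≠ 0 :=
  (withDensity_absolutelyContinuous _ _).ae_le (Measure.ae_ne volume 0)

/-- Almost surely each vector has positive distance to the span of the previous ones, as long as
there are at most `finrank ℝ E` of them. -/
lemma ae_det_gram_ne_zero {m : ℕ} (hm : m ≤ finrank ℝ E) :
    ∀ᵐ v ∂(Measure.pi fun _ : Fin m => stdGaussian E), (Matrix.gram ℝ v).det ≠ 0 := by
  induction m with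
  | zero => simp
  | succ m ih =>
    have h := measurePreserving_gramRatio_of_ae hm 0 (ih (Nat.le_of_succ_le hm))
    filter_upwards [h.quasiMeasurePreserving.ae (gammaMeasure_ae_ne_zero _ _)] with v hv h0
    simp [gramRatio, h0] at hv

lemma measurePreserving_gramRatio {m : ℕ} (hm : m < finrank ℝ E) (k : Fin (m + 1)) :
    MeasurePreserving (gramRatio (E := E) k)
      (Measure.pi fun _ : Fin (m + 1) => stdGaussian E)
      (gammaMeasure (((finrank ℝ E : ℝ) - m) / 2) (1 / 2)) :=
  measurePreserving_gramRatio_of_ae hm k (ae_det_gram_ne_zero hm.le)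

/-- The mean of the log-determinant of a Wishart matrix, by peeling off one chi-squared factor at a
time. -/
lemma integrable_and_integral_log_det_gram {m : ℕ} (hm : m ≤ finrank ℝ E) :
    Integrable (fun v : Fin m → E => log (Matrix.gram ℝ v).det)
      (Measure.pi fun _ : Fin m => stdGaussian E) ∧
    ∫ v, log (Matrix.gram ℝ v).det ∂(Measure.pi fun _ : Fin m => stdGaussian E) =
      multivariateDigamma m (finrank ℝ E / 2) + m * log 2 := by
  induction m with
  | zero => simp [multivariateDigamma]
  | succ m ih =>
    obtain ⟨ih1, ih2⟩ := ih (Nat.le_of_succ_le hm)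
    have h := measurePreserving_gramRatio hm 0
    have ha : 0 < ((finrank ℝ E : ℝ) - m) / 2 := by
      have : (m : ℝ) < finrank ℝ E := by exact_mod_cast hm
      linarith
    obtain ⟨h1, h2⟩ := integrable_and_integral_log_gammaMeasure ha (r := 1 / 2) (by norm_num)
    have htail : MeasurePreserving (fun v : Fin (m + 1) → E => v ∘ (0 : Fin (m + 1)).succAbove)
        (Measure.pi fun _ : Fin (m + 1) => stdGaussian E)
        (Measure.pi fun _ : Fin m => stdGaussian E) :=
      measurePreserving_snd.comp
        (measurePreserving_piFinSuccAbove (fun _ : Fin (m + 1) => stdGaussian E) 0)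
    have hlogm : AEStronglyMeasurable log (gammaMeasure (((finrank ℝ E : ℝ) - m) / 2) (1 / 2)) :=
      Real.measurable_log.aestronglyMeasurable
    have i1 := (h.integrable_comp hlogm).mpr h1
    have i2 := (htail.integrable_comp ih1.aestronglyMeasurable).mpr ih1
    have hae : (fun v : Fin (m + 1) → E => log (Matrix.gram ℝ v).det) =ᵐ[
        Measure.pi fun _ : Fin (m + 1) => stdGaussian E]
        (log ∘ gramRatio 0) +
        ((fun v : Fin m → E => log (Matrix.gram ℝ v).det) ∘
          fun v : Fin (m + 1) → E => v ∘ (0 : Fin (m + 1)).succAbove) := by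
      filter_upwards [ae_det_gram_ne_zero hm,
        htail.quasiMeasurePreserving.ae (ae_det_gram_ne_zero (Nat.le_of_succ_le hm))] with v h3 h4
      simp only [Pi.add_apply, Function.comp_apply]
      rw [gramRatio, Real.log_div h3 h4]
      simp only [Function.comp_def, sub_add_cancel]
    refine ⟨(i1.add i2).congr hae.symm, ?_⟩
    rw [integral_congr_ae hae, integral_add' i1 i2]
    have e1 := integral_map (μ := Measure.pi fun _ : Fin (m + 1) => stdGaussian E)
      h.measurable.aemeasurable (f := log) (by rw [h.map_eq]; exact hlogm)
    have e2 := integral_map (μ := Measure.pi fun _ : Fin (m + 1) => stdGaussian E)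
      htail.measurable.aemeasurable (f := fun v : Fin m → E => log (Matrix.gram ℝ v).det)
      (by rw [htail.map_eq]; exact ih1.aestronglyMeasurable)
    rw [h.map_eq] at e1
    rw [htail.map_eq] at e2
    simp only [Function.comp_def] at e1 e2 ⊢
    rw [← e1, ← e2, h2, ih2, multivariateDigamma, multivariateDigamma, Finset.sum_range_succ,
      one_div, Real.log_inv, sub_div]
    push_cast
    ring

lemma lintegral_inv_gram_apply_self {m : ℕ} (hm : m + 2 < finrank ℝ E) (k : Fin (m + 1)) :
    ∫⁻ v, ENNReal.ofReal ((Matrix.gram ℝ v)⁻¹ k k)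
      ∂(Measure.pi fun _ : Fin (m + 1) => stdGaussian E) =
      ENNReal.ofReal (1 / ((finrank ℝ E : ℝ) - m - 2)) := by
  have h := measurePreserving_gramRatio (E := E) (m := m) (by omega) k
  simp_rw [inv_gram_apply_self]
  have hm' : (m : ℝ) + 2 < finrank ℝ E := by exact_mod_cast hm
  rw [h.lintegral_comp (f := fun x : ℝ => ENNReal.ofReal x⁻¹) (by fun_prop),
    lintegral_inv_gammaMeasure (by linarith) (by norm_num)]
  congr 1
  have : (finrank ℝ E : ℝ) - m - 2 ≠ 0 := by linarith
  have : ((finrank ℝ E : ℝ) - m) / 2 - 1 ≠ 0 := by linarith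
  field_simp

lemma lintegral_inv_gram_apply_self_eq_top {m : ℕ} (hm : m < finrank ℝ E)
    (hm2 : finrank ℝ E ≤ m + 2) (k : Fin (m + 1)) :
    ∫⁻ v, ENNReal.ofReal ((Matrix.gram ℝ v)⁻¹ k k)
      ∂(Measure.pi fun _ : Fin (m + 1) => stdGaussian E) = ∞ := by
  have h := measurePreserving_gramRatio (E := E) (m := m) hm k
  simp_rw [inv_gram_apply_self]
  have hm' : (m : ℝ) < finrank ℝ E := by exact_mod_cast hm
  have hm2' : (finrank ℝ E : ℝ) ≤ m + 2 := by exact_mod_cast hm2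
  rw [h.lintegral_comp (f := fun x : ℝ => ENNReal.ofReal x⁻¹) (by fun_prop),
    lintegral_inv_gammaMeasure_eq_top (by linarith) (by linarith) (by norm_num)]

end GaussianGram

section GaussianDensity

/-! ### Densities, second moments and entropy of multivariate Gaussians -/

variable {d : ℕ} {A B S : Matrix (Fin d) (Fin d) ℝ}

open scoped MatrixOrder in
lemma exists_sqrt_multivariateGaussian_eq_map (hS : S.PosSemidef) :
    ∃ R : Matrix (Fin d) (Fin d) ℝ, Rᵀ = R ∧ R * R = S ∧
      multivariateGaussian 0 S =
        (stdGaussian (EuclideanSpace ℝ (Fin d))).map (Matrix.toEuclideanCLM (𝕜 := ℝ) R) := by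
  refine ⟨CFC.sqrt S, ?_, CFC.sqrt_mul_sqrt_self S hS.nonneg, ?_⟩
  · have h : (CFC.sqrt S)ᴴ = CFC.sqrt S := (CFC.sqrt_nonneg S).isSelfAdjoint
    rwa [Matrix.conjTranspose_eq_transpose_of_trivial] at h
  · simp [multivariateGaussian]

lemma gaussianCovDensity_pos (hS : S.PosDef) (x : EuclideanSpace ℝ (Fin d)) :
    0 < gaussianCovDensity S x := by
  have := hS.det_pos
  have := Real.pi_pos
  unfold gaussianCovDensity
  positivity

@[fun_prop]
lemma continuous_gaussianCovDensity : Continuous (gaussianCovDensity S) := by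
  unfold gaussianCovDensity
  fun_prop

lemma log_gaussianCovDensity (hS : S.PosDef) (x : EuclideanSpace ℝ (Fin d)) :
    log (gaussianCovDensity S x) =
      -(log ((2 * π) ^ d) + log S.det) / 2 - (x.ofLp ⬝ᵥ S⁻¹ *ᵥ x.ofLp) / 2 := by
  have hdet := hS.det_pos
  have hpi := Real.pi_pos
  have h1 : 0 < (2 * π) ^ d * S.det := by positivity
  rw [gaussianCovDensity, Real.log_mul (by positivity) (Real.exp_pos _).ne', Real.log_exp,
    Real.log_inv, Real.log_sqrt h1.le, Real.log_mul (by positivity) hdet.ne']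
  ring

/-- Change of variables from the standard Gaussian density along a square root of the
covariance. -/
lemma multivariateGaussian_eq_withDensity (hS : S.PosDef) :
    multivariateGaussian 0 S =
      volume.withDensity fun x => ENNReal.ofReal (gaussianCovDensity S x) := by
  obtain ⟨R, hRt, hRR, hmap⟩ := exists_sqrt_multivariateGaussian_eq_map hS.posSemidef
  have hdet := hS.det_pos
  have hpi := Real.pi_pos
  have hdetR : R.det * R.det = S.det := by rw [← Matrix.det_mul, hRR]
  have hR0 : R.det ≠ 0 := fun h => by rw [h] at hdetR; simp at hdetR; linarith
  have hRu : IsUnit R.det := hR0.isUnit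
  set T := Matrix.toEuclideanCLM (n := Fin d) (𝕜 := ℝ) R with hT
  have hTdet : LinearMap.det (T : EuclideanSpace ℝ (Fin d) →ₗ[ℝ] EuclideanSpace ℝ (Fin d)) =
      R.det := by
    rw [hT, Matrix.coe_toEuclideanCLM_eq_toEuclideanLin]
    exact LinearMap.det_toLpLin 2 R
  have hvol : Measure.map T volume = ENNReal.ofReal |R.det⁻¹| • volume := by
    have := Measure.map_linearMap_addHaar_eq_smul_addHaar
      (volume : Measure (EuclideanSpace ℝ (Fin d))) (f := T) (by rw [hTdet]; exact hR0)
    rw [hTdet] at this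
    exact this
  have hdens : ∀ x : EuclideanSpace ℝ (Fin d),
      (√((2 * π) ^ finrank ℝ (EuclideanSpace ℝ (Fin d))))⁻¹ * Real.exp (-‖x‖ ^ 2 / 2) =
      |R.det| * gaussianCovDensity S (T x) := by
    intro x
    have h1 : √((2 * π) ^ d * S.det) = √((2 * π) ^ d) * |R.det| := by
      rw [Real.sqrt_mul (by positivity), ← hdetR, Real.sqrt_mul_self_eq_abs]
    have h2 : (T x).ofLp ⬝ᵥ S⁻¹ *ᵥ (T x).ofLp = ‖x‖ ^ 2 := by
      rw [hT, Matrix.ofLp_toEuclideanCLM, ← hRR, Matrix.mul_inv_rev, Matrix.mulVec_mulVec,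
        Matrix.mul_assoc, Matrix.nonsing_inv_mul _ hRu, Matrix.mul_one,
        Matrix.dotProduct_mulVec, ← Matrix.mulVec_transpose, Matrix.mulVec_mulVec,
        Matrix.transpose_nonsing_inv, hRt, Matrix.nonsing_inv_mul _ hRu, Matrix.one_mulVec,
        EuclideanSpace.real_norm_sq_eq]
      simp [dotProduct, sq]
    have h3 : |R.det| ≠ 0 := abs_ne_zero.mpr hR0
    rw [gaussianCovDensity, h1, h2, finrank_euclideanSpace_fin]
    field_simp
  rw [hmap, stdGaussian_eq_withDensity]
  simp_rw [hdens]
  refine Measure.ext fun C hC => ?_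
  have hTm : Measurable T := by fun_prop
  have hfm : Measurable fun y => ENNReal.ofReal (|R.det| * gaussianCovDensity S y) := by fun_prop
  rw [Measure.map_apply hTm hC, withDensity_apply _ (hTm hC), withDensity_apply _ hC,
    ← setLIntegral_map hC hfm hTm, hvol, Measure.restrict_smul, lintegral_smul_measure,
    smul_eq_mul, ← lintegral_const_mul' _ _ ENNReal.ofReal_ne_top]
  refine lintegral_congr fun x => ?_
  rw [← ENNReal.ofReal_mul (abs_nonneg _), ← mul_assoc, ← abs_mul, inv_mul_cancel₀ hR0, abs_one,
    one_mul]

/-- The second moments of `N(0, S)`, contracted with a matrix. -/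
lemma integrable_and_integral_dotProduct_mulVec_multivariateGaussian (hS : S.PosSemidef) :
    Integrable (fun x : EuclideanSpace ℝ (Fin d) => x.ofLp ⬝ᵥ A *ᵥ x.ofLp)
      (multivariateGaussian 0 S) ∧
    ∫ x : EuclideanSpace ℝ (Fin d), x.ofLp ⬝ᵥ A *ᵥ x.ofLp ∂(multivariateGaussian 0 S) =
      (A * S).trace := by
  have hmem : ∀ i, MemLp (fun x : EuclideanSpace ℝ (Fin d) => x i) 2
      (multivariateGaussian 0 S) := fun i =>
    (EuclideanSpace.proj (𝕜 := ℝ) i).comp_memLp' IsGaussian.memLp_two_id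
  have hzero : ∀ i, ∫ x : EuclideanSpace ℝ (Fin d), x i ∂(multivariateGaussian 0 S) = 0 := by
    intro i
    have := (EuclideanSpace.proj (𝕜 := ℝ) i).integral_comp_id_comm
      (μ := multivariateGaussian (0 : EuclideanSpace ℝ (Fin d)) S) IsGaussian.integrable_id
    simpa using this
  have hint : ∀ i j, Integrable (fun x : EuclideanSpace ℝ (Fin d) => x i * x j)
      (multivariateGaussian 0 S) := fun i j => (hmem i).integrable_mul (hmem j)
  have hval : ∀ i j, ∫ x : EuclideanSpace ℝ (Fin d), x i * x j ∂(multivariateGaussian 0 S) =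
      S i j := by
    intro i j
    have h := covariance_eval_multivariateGaussian (μ := 0) hS i j
    rw [covariance_eq_sub (hmem i) (hmem j), hzero, zero_mul, sub_zero] at h
    exact h
  have hexp : ∀ x : EuclideanSpace ℝ (Fin d), x.ofLp ⬝ᵥ A *ᵥ x.ofLp =
      ∑ i, ∑ j, A i j * (x j * x i) := by
    intro x
    simp only [dotProduct, Matrix.mulVec, Finset.mul_sum]
    refine Finset.sum_congr rfl fun i _ => Finset.sum_congr rfl fun j _ => ?_
    ring
  simp_rw [hexp]
  refine ⟨integrable_finsetSum _ fun i _ => integrable_finsetSum _ fun j _ =>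
    (hint j i).const_mul _, ?_⟩
  rw [integral_finsetSum (f := fun i (x : EuclideanSpace ℝ (Fin d)) =>
    ∑ j, A i j * (x j * x i)) Finset.univ fun i _ =>
    integrable_finsetSum _ fun j _ => (hint j i).const_mul _]
  simp only [Matrix.trace, Matrix.diag, Matrix.mul_apply]
  refine Finset.sum_congr rfl fun i _ => ?_
  rw [integral_finsetSum (f := fun j (x : EuclideanSpace ℝ (Fin d)) => A i j * (x j * x i))
    Finset.univ fun j _ => (hint j i).const_mul _]
  refine Finset.sum_congr rfl fun j _ => ?_
  rw [integral_const_mul, hval]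

lemma integrable_and_integral_log_gaussianCovDensity (hA : A.PosSemidef) (hB : B.PosDef) :
    Integrable (fun x => log (gaussianCovDensity B x)) (multivariateGaussian 0 A) ∧
    ∫ x, log (gaussianCovDensity B x) ∂(multivariateGaussian 0 A) =
      -(log ((2 * π) ^ d) + log B.det + (B⁻¹ * A).trace) / 2 := by
  obtain ⟨h1, h2⟩ := integrable_and_integral_dotProduct_mulVec_multivariateGaussian (A := B⁻¹) hA
  simp_rw [log_gaussianCovDensity hB]
  refine ⟨(integrable_const _).sub (h1.div_const 2), ?_⟩
  rw [integral_sub (integrable_const _) (h1.div_const 2), integral_const, integral_div, h2,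
    probReal_univ, one_smul]
  ring

lemma gaussianCovEntropy_eq (hS : S.PosDef) :
    gaussianCovEntropy S = -(log ((2 * π) ^ d) + log S.det + d) / 2 := by
  rw [gaussianCovEntropy, (integrable_and_integral_log_gaussianCovDensity hS.posSemidef hS).2,
    Matrix.nonsing_inv_mul _ hS.det_pos.ne'.isUnit]
  simp

end GaussianDensity

section GaussianKL

/-! ### The Kullback-Leibler divergence between centred Gaussians -/

variable {d : ℕ} {A B S : Matrix (Fin d) (Fin d) ℝ}

/-- The closed form `(tr (B⁻¹ A) - d - log det A + log det B) / 2` of the divergence of `N(0, A)`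
from `N(0, B)`, also known as Stein's loss. -/
noncomputable def steinLoss {d : ℕ} (A B : Matrix (Fin d) (Fin d) ℝ) : ℝ :=
  ((B⁻¹ * A).trace - d - log A.det + log B.det) / 2

lemma gaussianCovKL_ne_top_and_toReal (hA : A.PosDef) (hB : B.PosDef) :
    gaussianCovKL A B ≠ ∞ ∧ (gaussianCovKL A B).toReal = steinLoss A B := by
  set μ := multivariateGaussian (0 : EuclideanSpace ℝ (Fin d)) A with hμ
  set ν := multivariateGaussian (0 : EuclideanSpace ℝ (Fin d)) B with hν
  have hμd := multivariateGaussian_eq_withDensity hA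
  have hνd := multivariateGaussian_eq_withDensity hB
  have hμv : μ ≪ volume := by rw [hμ, hμd]; exact withDensity_absolutelyContinuous _ _
  have hfm : Measurable fun x => ENNReal.ofReal (gaussianCovDensity A x) := by fun_prop
  have hgm : Measurable fun x => ENNReal.ofReal (gaussianCovDensity B x) := by fun_prop
  have hg0 : ∀ᵐ x, ENNReal.ofReal (gaussianCovDensity B x) ≠ 0 := ae_of_all _ fun x => by
    simpa using gaussianCovDensity_pos hB x
  have hvν : volume ≪ ν := by
    rw [hν, hνd]
    exact withDensity_absolutelyContinuous' hgm.aemeasurable hg0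
  have hac : μ ≪ ν := hμv.trans hvν
  have hllr : llr μ ν =ᵐ[μ] fun x =>
      log (gaussianCovDensity A x) - log (gaussianCovDensity B x) := by
    refine hμv.ae_le ?_
    have h1 := Measure.rnDeriv_withDensity_right μ volume hgm.aemeasurable hg0
      (ae_of_all _ fun x => ENNReal.ofReal_ne_top)
    have h2 := Measure.rnDeriv_withDensity volume hfm
    rw [← hμd, ← hμ] at h2
    rw [← hνd, ← hν] at h1
    filter_upwards [h1, h2] with x hx1 hx2
    have hfx := gaussianCovDensity_pos hA x
    have hgx := gaussianCovDensity_pos hB x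
    rw [llr, hx1, hx2, ENNReal.toReal_mul, ENNReal.toReal_inv, ENNReal.toReal_ofReal hgx.le,
      ENNReal.toReal_ofReal hfx.le, Real.log_mul (inv_ne_zero hgx.ne') hfx.ne', Real.log_inv]
    ring
  obtain ⟨i1, e1⟩ := integrable_and_integral_log_gaussianCovDensity hA.posSemidef hA
  obtain ⟨i2, e2⟩ := integrable_and_integral_log_gaussianCovDensity hA.posSemidef hB
  refine ⟨klDiv_ne_top hac ((i1.sub i2).congr hllr.symm), ?_⟩
  rw [gaussianCovKL, ← hμ, ← hν, toReal_klDiv_of_measure_eq hac (by simp), integral_congr_ae hllr,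
    integral_sub i1 i2, e1, e2, Matrix.nonsing_inv_mul _ hA.det_pos.ne'.isUnit, steinLoss]
  simp only [Matrix.trace_one, Fintype.card_fin]
  ring

lemma gaussianCovKL_eq_ofReal (hA : A.PosDef) (hB : B.PosDef) :
    gaussianCovKL A B = ENNReal.ofReal (steinLoss A B) := by
  obtain ⟨h1, h2⟩ := gaussianCovKL_ne_top_and_toReal hA hB
  rw [← h2, ENNReal.ofReal_toReal h1]

/-- A singular Gaussian is carried by a hyperplane, which is a null set for a nondegenerate one. -/
lemma gaussianCovKL_eq_top (hA : A.PosDef) (hB : B.PosSemidef) (hdet : B.det = 0) :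
    gaussianCovKL A B = ∞ := by
  refine klDiv_of_not_ac fun hac => ?_
  -- A kernel vector `v` of `B` is also one of the square root `R`, so `N(0, B)` lives on `vᗮ`.
  obtain ⟨R, hRt, hRR, hmap⟩ := exists_sqrt_multivariateGaussian_eq_map hB
  obtain ⟨v, hv0, hv⟩ := Matrix.exists_mulVec_eq_zero_iff.mpr hdet
  have hRv : R *ᵥ v = 0 := by
    rw [← dotProduct_self_eq_zero (v := R *ᵥ v), Matrix.dotProduct_mulVec,
      ← Matrix.mulVec_transpose, hRt, Matrix.mulVec_mulVec, hRR, hv, zero_dotProduct]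
  let w : EuclideanSpace ℝ (Fin d) := WithLp.toLp 2 v
  have hw0 : w ≠ 0 := by simpa [w] using hv0
  let H : Submodule ℝ (EuclideanSpace ℝ (Fin d)) := (Submodule.span ℝ {w})ᗮ
  have hHm : MeasurableSet (H : Set (EuclideanSpace ℝ (Fin d))) :=
    H.closed_of_finiteDimensional.measurableSet
  have hν : multivariateGaussian (0 : EuclideanSpace ℝ (Fin d)) B (H : Set _)ᶜ = 0 := by
    rw [hmap, Measure.map_apply (by fun_prop) hHm.compl]
    convert measure_empty (μ := stdGaussian (EuclideanSpace ℝ (Fin d)))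
    ext x
    simp only [Set.mem_preimage, Set.mem_compl_iff, SetLike.mem_coe, Set.mem_empty_iff_false,
      iff_false, not_not, H, Submodule.mem_orthogonal_singleton_iff_inner_right]
    simp only [EuclideanSpace.inner_eq_star_dotProduct, Matrix.ofLp_toEuclideanCLM, w]
    rw [star_trivial, dotProduct_comm, Matrix.dotProduct_mulVec, ← Matrix.mulVec_transpose, hRt,
      hRv, zero_dotProduct]
  have hμ : multivariateGaussian (0 : EuclideanSpace ℝ (Fin d)) A (H : Set _) = 0 := by
    rw [multivariateGaussian_eq_withDensity hA]
    refine withDensity_absolutelyContinuous _ _ (Measure.addHaar_submodule _ H fun htop => hw0 ?_)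
    have : w ∈ H := by rw [htop]; trivial
    rwa [Submodule.mem_orthogonal_singleton_iff_inner_right, inner_self_eq_zero] at this
  have h1 := hac hν
  rw [prob_compl_eq_zero_iff hHm, hμ] at h1
  exact zero_ne_one h1

lemma steinLoss_nonneg (hA : A.PosDef) (hB : B.PosDef) : 0 ≤ steinLoss A B := by
  rw [← (gaussianCovKL_ne_top_and_toReal hA hB).2]
  exact ENNReal.toReal_nonneg

lemma eq_of_multivariateGaussian_eq (hA : A.PosSemidef) (hB : B.PosSemidef)
    (h : multivariateGaussian (0 : EuclideanSpace ℝ (Fin d)) A = multivariateGaussian 0 B) :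
    A = B := by
  ext i j
  rw [← covariance_eval_multivariateGaussian (μ := 0) hA, h,
    covariance_eval_multivariateGaussian hB]

/-- The divergence vanishes only for equal measures, and these have equal covariances. -/
lemma eq_of_steinLoss_eq_zero (hA : A.PosDef) (hB : B.PosDef) (h : steinLoss A B = 0) :
    A = B := by
  have h1 : gaussianCovKL A B = 0 := by rw [gaussianCovKL_eq_ofReal hA hB, h, ENNReal.ofReal_zero]
  exact eq_of_multivariateGaussian_eq hA.posSemidef hB.posSemidef (klDiv_eq_zero_iff.mp h1)

/-- Nonnegativity of `steinLoss A (2 • B)` shows that the trace term dominates the logarithmic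
one. -/
lemma le_steinLoss (hA : A.PosDef) (hB : B.PosDef) :
    (B⁻¹ * A).trace / 4 - d * log 2 / 2 ≤ steinLoss A B := by
  have h2B : ((2 : ℝ) • B).PosDef := hB.smul (by norm_num)
  have h := steinLoss_nonneg hA h2B
  have hdet := hB.det_pos
  rw [steinLoss, Matrix.det_smul, Fintype.card_fin, Real.log_mul (by positivity) hdet.ne',
    Real.log_pow, Matrix.inv_smul B (2 : ℝ) hdet.ne'.isUnit, Matrix.smul_mul,
    Matrix.trace_smul] at h
  simp only [smul_eq_mul, invOf_eq_inv] at h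
  rw [steinLoss]
  linarith

end GaussianKL

section Bregman

/-! ### The Bregman divergence of the entropy -/

variable {d : ℕ} {A B : Matrix (Fin d) (Fin d) ℝ}

/-- Positive definiteness is an open condition within the symmetric matrices, by compactness of
the unit sphere. -/
lemma eventually_posDef_add_smul {V : Matrix (Fin d) (Fin d) ℝ} (hB : B.PosDef)
    (hV : V.IsHermitian) : ∀ᶠ t : ℝ in nhds 0, (B + t • V).PosDef := by
  have hK : IsCompact (Metric.sphere (0 : Fin d → ℝ) 1) := isCompact_sphere 0 1
  have hev := hK.eventually_forall_of_forall_eventually (x₀ := (0 : ℝ))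
    (P := fun t x => 0 < x ⬝ᵥ (B + t • V) *ᵥ x) fun x hx => by
      have hcont : Continuous fun z : ℝ × (Fin d → ℝ) => z.2 ⬝ᵥ (B + z.1 • V) *ᵥ z.2 := by
        fun_prop
      refine hcont.continuousAt.eventually (lt_mem_nhds ?_)
      have hx0 : x ≠ 0 := by
        rintro rfl
        simp at hx
      simpa using hB.dotProduct_mulVec_pos hx0
  filter_upwards [hev] with t ht
  refine Matrix.PosDef.of_dotProduct_mulVec_pos ?_ fun x hx => ?_
  · refine hB.isHermitian.add ?_
    rw [Matrix.IsHermitian, Matrix.conjTranspose_smul, hV, star_trivial]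
  · have hn : 0 < ‖x‖ := norm_pos_iff.mpr hx
    have h1 := ht (‖x‖⁻¹ • x) (by simp [norm_smul, hn.ne'])
    rw [Matrix.mulVec_smul, dotProduct_smul, smul_dotProduct, smul_smul, smul_eq_mul] at h1
    rw [star_trivial]
    exact pos_of_mul_pos_right h1 (by positivity)

lemma hasDerivAt_det_add_smul (V : Matrix (Fin d) (Fin d) ℝ) (hB : B.det ≠ 0) :
    HasDerivAt (fun t : ℝ => (B + t • V).det) (B.det * (B⁻¹ * V).trace) 0 := by
  have h1 : ∀ t : ℝ, (B + t • V).det = B.det * (1 + t • (B⁻¹ * V)).det := by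
    intro t
    rw [← Matrix.det_mul, Matrix.mul_add, Matrix.mul_one, Matrix.mul_smul,
      Matrix.mul_nonsing_inv_cancel_left _ _ hB.isUnit]
  simp only [h1]
  simp only [fun t : ℝ => Matrix.det_one_add_smul t (B⁻¹ * V)]
  set q := (1 + (Polynomial.X : Polynomial ℝ) • (B⁻¹ * V).map Polynomial.C).det.divX.divX
  have h2 := (((hasDerivAt_id (0 : ℝ)).const_mul (B⁻¹ * V).trace).const_add 1).add
    ((q.hasDerivAt 0).mul (hasDerivAt_pow 2 (0 : ℝ)))
  simpa using h2.const_mul B.det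

lemma lineDeriv_gaussianCovEntropy {V : Matrix (Fin d) (Fin d) ℝ} (hB : B.PosDef)
    (hV : V.IsHermitian) :
    lineDeriv ℝ gaussianCovEntropy B V = -(B⁻¹ * V).trace / 2 := by
  have hdet := hB.det_pos
  have hev : (fun t : ℝ => gaussianCovEntropy (B + t • V)) =ᶠ[nhds 0]
      fun t => -(log ((2 * π) ^ d) + log (B + t • V).det + d) / 2 := by
    filter_upwards [eventually_posDef_add_smul hB hV] with t ht using gaussianCovEntropy_eq ht
  have h1 := (hasDerivAt_det_add_smul V hdet.ne').log (by simpa using hdet.ne')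
  have h2 := (((h1.const_add (log ((2 * π) ^ d))).add_const (d : ℝ)).neg.div_const 2)
  rw [lineDeriv, hev.deriv_eq]
  refine h2.deriv.trans ?_
  simp [hdet.ne']

lemma bregmanDivergence_gaussianCovEntropy (hA : A.PosDef) (hB : B.PosDef) :
    bregmanDivergence gaussianCovEntropy A B = steinLoss A B := by
  rw [bregmanDivergence, lineDeriv_gaussianCovEntropy hB (hA.isHermitian.sub hB.isHermitian),
    gaussianCovEntropy_eq hA, gaussianCovEntropy_eq hB, Matrix.mul_sub, Matrix.trace_sub,
    Matrix.nonsing_inv_mul _ hB.det_pos.ne'.isUnit, steinLoss]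
  simp only [Matrix.trace_one, Fintype.card_fin]
  ring

end Bregman

section MaximumLikelihood

/-! ### The maximum likelihood estimate -/

variable {d n : ℕ}

lemma posSemidef_sampleCov (x : Fin n → EuclideanSpace ℝ (Fin d)) : (sampleCov x).PosSemidef := by
  refine Matrix.PosSemidef.smul (Matrix.posSemidef_sum _ fun i _ => ?_) (by positivity)
  simpa using Matrix.posSemidef_vecMulVec_self_star (x i).ofLp

lemma gaussianCovLikelihood_pos (x : Fin n → EuclideanSpace ℝ (Fin d))
    {S : Matrix (Fin d) (Fin d) ℝ} (hS : S.PosDef) : 0 < gaussianCovLikelihood x S :=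
  Finset.prod_pos fun i _ => gaussianCovDensity_pos hS (x i)

lemma trace_mul_sampleCov (hn : n ≠ 0) (x : Fin n → EuclideanSpace ℝ (Fin d))
    (A : Matrix (Fin d) (Fin d) ℝ) :
    n * (A * sampleCov x).trace = ∑ i, (x i).ofLp ⬝ᵥ A *ᵥ (x i).ofLp := by
  have hn' : (n : ℝ) ≠ 0 := by exact_mod_cast hn
  rw [sampleCov, Matrix.mul_smul, Matrix.trace_smul, smul_eq_mul, mul_inv_cancel_left₀ hn',
    Matrix.mul_sum, Matrix.trace_sum]
  refine Finset.sum_congr rfl fun i _ => ?_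
  rw [Matrix.mul_vecMulVec, Matrix.trace_vecMulVec, dotProduct_comm]

lemma log_gaussianCovLikelihood (hn : n ≠ 0) (x : Fin n → EuclideanSpace ℝ (Fin d))
    {S : Matrix (Fin d) (Fin d) ℝ} (hS : S.PosDef) :
    log (gaussianCovLikelihood x S) =
      -(n * (log ((2 * π) ^ d) + log S.det + (S⁻¹ * sampleCov x).trace)) / 2 := by
  rw [gaussianCovLikelihood, Real.log_prod fun i _ => (gaussianCovDensity_pos hS (x i)).ne']
  simp_rw [log_gaussianCovDensity hS]
  rw [Finset.sum_sub_distrib, ← Finset.sum_div, ← Finset.sum_div, ← trace_mul_sampleCov hn]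
  simp only [Finset.sum_const, Finset.card_univ, Fintype.card_fin, nsmul_eq_mul]
  ring

/-- The log-likelihood falls short of its value at the sample covariance by `n` times the
divergence. -/
lemma log_gaussianCovLikelihood_sampleCov_sub (hn : n ≠ 0) (x : Fin n → EuclideanSpace ℝ (Fin d))
    {S : Matrix (Fin d) (Fin d) ℝ} (hS : S.PosDef) (hM : (sampleCov x).PosDef) :
    log (gaussianCovLikelihood x (sampleCov x)) - log (gaussianCovLikelihood x S) =
      n * steinLoss (sampleCov x) S := by
  rw [log_gaussianCovLikelihood hn x hS, log_gaussianCovLikelihood hn x hM,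
    Matrix.nonsing_inv_mul _ hM.det_pos.ne'.isUnit, steinLoss]
  simp only [Matrix.trace_one, Fintype.card_fin]
  ring

lemma isGaussianCovMLE_iff_eq_sampleCov (hn : n ≠ 0) (x : Fin n → EuclideanSpace ℝ (Fin d))
    (hM : (sampleCov x).PosDef) (S : Matrix (Fin d) (Fin d) ℝ) :
    IsGaussianCovMLE x S ↔ S = sampleCov x := by
  have hn' : (0 : ℝ) < n := by exact_mod_cast Nat.pos_of_ne_zero hn
  constructor
  · rintro ⟨hS, hmax⟩
    have h1 := Real.log_le_log (gaussianCovLikelihood_pos x hM) (hmax _ hM)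
    have h2 := log_gaussianCovLikelihood_sampleCov_sub hn x hS hM
    have h3 := steinLoss_nonneg hM hS
    have h4 : steinLoss (sampleCov x) S = 0 := by
      refine le_antisymm ?_ h3
      by_contra! h
      have := mul_pos hn' h
      linarith
    exact (eq_of_steinLoss_eq_zero hM hS h4).symm
  · rintro rfl
    refine ⟨hM, fun S' hS' => ?_⟩
    rw [← Real.log_le_log_iff (gaussianCovLikelihood_pos x hS') (gaussianCovLikelihood_pos x hM)]
    have h2 := log_gaussianCovLikelihood_sampleCov_sub hn x hS' hM
    have := mul_nonneg hn'.le (steinLoss_nonneg hM hS')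
    linarith

end MaximumLikelihood

section Transposition

/-! ### From a sample of vectors to independent rows -/

/-- Transposing an array with independent, identically distributed entries preserves its law. -/
lemma measurePreserving_swap_pi_pi {ι κ α : Type*} [Fintype ι] [Fintype κ] [MeasurableSpace α]
    (γ : Measure α) [SigmaFinite γ] :
    MeasurePreserving (Function.swap : (κ → ι → α) → ι → κ → α)
      (Measure.pi fun _ => Measure.pi fun _ => γ) (Measure.pi fun _ => Measure.pi fun _ => γ) := by
  have hmeas : Measurable (Function.swap : (κ → ι → α) → ι → κ → α) := by
    unfold Function.swap
    fun_prop
  refine ⟨hmeas, Eq.symm ?_⟩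
  refine Measure.pi_eq_generateFrom (fun _ => generateFrom_pi) (fun _ => isPiSystem_pi)
    (fun _ => Measure.FiniteSpanningSetsIn.pi fun _ => γ.toFiniteSpanningSetsIn) fun s hs => ?_
  choose t ht hts using hs
  have htm : ∀ i k, MeasurableSet (t i k) := fun i k => ht i k (Set.mem_univ k)
  have hpre : Function.swap ⁻¹' Set.pi Set.univ s =
      Set.pi Set.univ fun k => Set.pi Set.univ fun i => t i k := by
    ext w
    simp only [← hts, Set.mem_preimage, Set.mem_pi, Set.mem_univ, true_implies, Function.swap]
    exact forall_comm
  rw [Measure.map_apply hmeas, hpre, Measure.pi_pi]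
  · simp_rw [← hts, Measure.pi_pi]
    exact Finset.prod_comm
  · exact MeasurableSet.univ_pi fun i => hts i ▸ MeasurableSet.univ_pi (htm i)

lemma measurePreserving_toLp_pi_gaussianReal {ι : Type*} [Fintype ι] :
    MeasurePreserving (WithLp.toLp 2) (Measure.pi fun _ : ι => gaussianReal 0 1)
      (stdGaussian (EuclideanSpace ℝ ι)) :=
  ⟨by fun_prop, map_pi_eq_stdGaussian⟩

/-- The columns of the matrix with rows `v k`, as a sample of vectors. -/
def columns {d n : ℕ} (v : Fin d → EuclideanSpace ℝ (Fin n)) :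
    Fin n → EuclideanSpace ℝ (Fin d) :=
  fun i => WithLp.toLp 2 fun k => v k i

lemma measurePreserving_columns {d n : ℕ} :
    MeasurePreserving (columns (d := d) (n := n))
      (Measure.pi fun _ => stdGaussian (EuclideanSpace ℝ (Fin n)))
      (Measure.pi fun _ => stdGaussian (EuclideanSpace ℝ (Fin d))) := by
  have hrow := measurePreserving_pi (ι := Fin d) _ _
    fun _ => measurePreserving_toLp_pi_gaussianReal (ι := Fin n)
  have hcol := measurePreserving_pi (ι := Fin n) _ _
    fun _ => measurePreserving_toLp_pi_gaussianReal (ι := Fin d)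
  have hmeas : Measurable (columns (d := d) (n := n)) := by
    unfold columns
    fun_prop
  refine ⟨hmeas, ?_⟩
  rw [← hrow.map_eq, Measure.map_map hmeas hrow.measurable]
  exact (hcol.comp (measurePreserving_swap_pi_pi (gaussianReal 0 1))).map_eq

end Transposition

section SampleCovariance

/-! ### The law of the sample covariance -/

variable {d n : ℕ} {S : Matrix (Fin d) (Fin d) ℝ}

lemma sampleCov_toEuclideanCLM_columns {R : Matrix (Fin d) (Fin d) ℝ} (hR : Rᵀ = R)
    (v : Fin d → EuclideanSpace ℝ (Fin n)) :
    sampleCov (fun i => Matrix.toEuclideanCLM (𝕜 := ℝ) R (columns v i)) =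
      (n : ℝ)⁻¹ • (R * Matrix.gram ℝ v * R) := by
  have h1 : Matrix.gram ℝ v = ∑ i, Matrix.vecMulVec (columns v i).ofLp (columns v i).ofLp := by
    ext k l
    simp only [Matrix.gram_apply, Matrix.sum_apply, Matrix.vecMulVec_apply, columns,
      PiLp.inner_apply]
    refine Finset.sum_congr rfl fun i _ => ?_
    simp [mul_comm]
  rw [sampleCov, h1, Matrix.mul_sum, Matrix.sum_mul]
  congr 1
  refine Finset.sum_congr rfl fun i _ => ?_
  rw [Matrix.mul_vecMulVec, Matrix.vecMulVec_mul, Matrix.ofLp_toEuclideanCLM,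
    ← Matrix.mulVec_transpose, hR]

lemma posDef_sampleCov_iff_det_ne_zero (x : Fin n → EuclideanSpace ℝ (Fin d)) :
    (sampleCov x).PosDef ↔ (sampleCov x).det ≠ 0 :=
  (posSemidef_sampleCov x).posDef_iff_det_ne_zero

lemma continuous_sampleCov :
    Continuous fun x : Fin n → EuclideanSpace ℝ (Fin d) => sampleCov x := by
  refine continuous_matrix fun k l => ?_
  simp only [sampleCov, Matrix.smul_apply, Matrix.sum_apply, Matrix.vecMulVec_apply]
  fun_prop

/-- The divergence is `∞` on the measurable set where the sample covariance is singular, and equal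
to Stein's loss elsewhere. -/
lemma measurable_gaussianCovKL_sampleCov (hS : S.PosDef) :
    Measurable fun x : Fin n → EuclideanSpace ℝ (Fin d) => gaussianCovKL S (sampleCov x) := by
  classical
  have hdet : Measurable fun x : Fin n → EuclideanSpace ℝ (Fin d) => (sampleCov x).det :=
    continuous_sampleCov.matrix_det.measurable
  have htr : Measurable fun x : Fin n → EuclideanSpace ℝ (Fin d) =>
      ((sampleCov x)⁻¹ * S).trace := by
    simp_rw [Matrix.inv_def, Ring.inverse_eq_inv', Matrix.smul_mul, Matrix.trace_smul, smul_eq_mul]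
    exact hdet.inv.mul
      (((continuous_sampleCov.matrix_adjugate.matrix_mul continuous_const).matrix_trace).measurable)
  have heq : (fun x : Fin n → EuclideanSpace ℝ (Fin d) => gaussianCovKL S (sampleCov x)) =
      fun x => if (sampleCov x).det = 0 then ∞ else ENNReal.ofReal (steinLoss S (sampleCov x)) := by
    ext x
    split_ifs with h
    · exact gaussianCovKL_eq_top hS (posSemidef_sampleCov x) h
    · exact gaussianCovKL_eq_ofReal hS ((posDef_sampleCov_iff_det_ne_zero x).mpr h)
  rw [heq]
  refine Measurable.ite (hdet (measurableSet_singleton 0)) measurable_const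
    (Measurable.ennreal_ofReal ?_)
  unfold steinLoss
  fun_prop

/-- The law of a Gaussian sample is the image of that of independent standard Gaussian rows under a
map that turns the sample covariance into a congruence transform of the Gram matrix of the rows,
so that the Kullback-Leibler divergence depends on this Gram matrix only. -/
lemma exists_measurePreserving_sampleCov (hn : n ≠ 0) (hS : S.PosDef) :
    ∃ T : (Fin d → EuclideanSpace ℝ (Fin n)) → Fin n → EuclideanSpace ℝ (Fin d),
      MeasurePreserving T (Measure.pi fun _ => stdGaussian (EuclideanSpace ℝ (Fin n)))
        (Measure.pi fun _ => multivariateGaussian 0 S) ∧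
      (∀ v, (sampleCov (T v)).det = ((n : ℝ)⁻¹) ^ d * S.det * (Matrix.gram ℝ v).det) ∧
      ∀ v, (Matrix.gram ℝ v).det ≠ 0 →
        ((sampleCov (T v))⁻¹ * S).trace = n * ((Matrix.gram ℝ v)⁻¹).trace := by
  have hn' : (n : ℝ) ≠ 0 := by exact_mod_cast hn
  obtain ⟨R, hRt, hRR, hmap⟩ := exists_sqrt_multivariateGaussian_eq_map hS.posSemidef
  have hdetR : R.det * R.det = S.det := by rw [← Matrix.det_mul, hRR]
  have hR0 : R.det ≠ 0 := fun h => by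
    have := hS.det_pos
    rw [h] at hdetR; simp at hdetR; linarith
  have hRu : IsUnit R.det := hR0.isUnit
  have hRmap : MeasurePreserving (Matrix.toEuclideanCLM (𝕜 := ℝ) R)
      (stdGaussian (EuclideanSpace ℝ (Fin d))) (multivariateGaussian 0 S) :=
    ⟨by fun_prop, hmap.symm⟩
  refine ⟨fun v i => Matrix.toEuclideanCLM (𝕜 := ℝ) R (columns v i),
    (measurePreserving_pi _ _ fun _ => hRmap).comp measurePreserving_columns, fun v => ?_,
    fun v hv => ?_⟩
  · rw [sampleCov_toEuclideanCLM_columns hRt, Matrix.det_smul, Matrix.det_mul, Matrix.det_mul,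
      ← hdetR, Fintype.card_fin]
    ring
  · have hinv : ((n : ℝ)⁻¹ • (R * Matrix.gram ℝ v * R))⁻¹ =
        (n : ℝ) • (R⁻¹ * (Matrix.gram ℝ v)⁻¹ * R⁻¹) := by
      refine Matrix.inv_eq_left_inv ?_
      rw [Matrix.smul_mul, Matrix.mul_smul, smul_smul, mul_inv_cancel₀ hn', one_smul]
      simp only [Matrix.mul_assoc]
      rw [Matrix.nonsing_inv_mul_cancel_left _ _ hRu,
        Matrix.nonsing_inv_mul_cancel_left _ _ hv.isUnit, Matrix.nonsing_inv_mul _ hRu]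
    rw [sampleCov_toEuclideanCLM_columns hRt, hinv, Matrix.smul_mul, Matrix.trace_smul, ← hRR,
      smul_eq_mul, Matrix.mul_assoc, Matrix.nonsing_inv_mul_cancel_left _ _ hRu,
      Matrix.trace_mul_comm, Matrix.mul_nonsing_inv_cancel_left _ _ hRu]

end SampleCovariance

section Expectation

/-! ### The expected divergence -/

lemma det_gram_eq_zero_of_finrank_lt {E : Type*} [NormedAddCommGroup E] [InnerProductSpace ℝ E]
    [FiniteDimensional ℝ E] {d : ℕ} (h : finrank ℝ E < d) (v : Fin d → E) :
    (Matrix.gram ℝ v).det = 0 := by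
  by_contra h0
  have := (Matrix.linearIndependent_of_det_gram_ne_zero h0).fintype_card_le_finrank
  simp at this
  omega

lemma posDef_gram_of_det_ne_zero {E : Type*} [NormedAddCommGroup E] [InnerProductSpace ℝ E]
    {d : ℕ} {v : Fin d → E} (h : (Matrix.gram ℝ v).det ≠ 0) : (Matrix.gram ℝ v).PosDef :=
  (Matrix.posSemidef_gram ℝ v).posDef_iff_det_ne_zero.mpr h

variable {d n : ℕ} {S : Matrix (Fin d) (Fin d) ℝ}

lemma ae_posDef_sampleCov (hn : n ≠ 0) (hdn : d ≤ n) (hS : S.PosDef) :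
    ∀ᵐ x ∂(Measure.pi fun _ : Fin n => multivariateGaussian (0 : EuclideanSpace ℝ (Fin d)) S),
      (sampleCov x).PosDef := by
  have hn' : (n : ℝ) ≠ 0 := by exact_mod_cast hn
  obtain ⟨T, hT, hdet, -⟩ := exists_measurePreserving_sampleCov hn hS
  simp_rw [posDef_sampleCov_iff_det_ne_zero]
  rw [← hT.map_eq, ae_map_iff hT.measurable.aemeasurable]
  · filter_upwards [ae_det_gram_ne_zero (E := EuclideanSpace ℝ (Fin n)) (m := d)
      (by simpa using hdn)] with v hv
    rw [hdet]
    have := hS.det_pos.ne'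
    positivity
  · exact (continuous_sampleCov.matrix_det.measurable (measurableSet_singleton 0)).compl

/-- Below the threshold either the sample covariance is singular, or the divergence dominates a
diagonal entry of an inverse Wishart matrix, whose mean is infinite. -/
lemma lintegral_gaussianCovKL_sampleCov_eq_top (hd : 1 ≤ d) (hn : n ≠ 0) (hdn : n ≤ d + 1)
    (hS : S.PosDef) :
    ∫⁻ x, gaussianCovKL S (sampleCov x)
      ∂(Measure.pi fun _ : Fin n => multivariateGaussian (0 : EuclideanSpace ℝ (Fin d)) S) = ∞ := by
  have hn' : (0 : ℝ) < n := by exact_mod_cast Nat.pos_of_ne_zero hn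
  obtain ⟨T, hT, hdet, htr⟩ := exists_measurePreserving_sampleCov hn hS
  rw [← hT.lintegral_comp (measurable_gaussianCovKL_sampleCov hS)]
  rcases lt_or_ge n d with h | h
  · have hinf : ∀ v, gaussianCovKL S (sampleCov (T v)) = ∞ := fun v =>
      gaussianCovKL_eq_top hS (posSemidef_sampleCov _) (by
        rw [hdet, det_gram_eq_zero_of_finrank_lt (by simpa using h), mul_zero])
    simp [hinf]
  · obtain ⟨m, rfl⟩ : ∃ m, d = m + 1 := ⟨d - 1, by omega⟩
    have hmn : m < finrank ℝ (EuclideanSpace ℝ (Fin n)) := by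
      rw [finrank_euclideanSpace_fin]; omega
    have htop := lintegral_inv_gram_apply_self_eq_top hmn (by
      rw [finrank_euclideanSpace_fin]; omega) 0
    set c : ℝ := ((m + 1 : ℕ) : ℝ) * log 2 / 2 with hc
    -- The constant `c` compensates the logarithmic term in the lower bound for Stein's loss.
    have hle : ∀ᵐ v ∂(Measure.pi fun _ : Fin (m + 1) => stdGaussian (EuclideanSpace ℝ (Fin n))),
        ENNReal.ofReal (n / 4) * ENNReal.ofReal ((Matrix.gram ℝ v)⁻¹ 0 0) ≤
          gaussianCovKL S (sampleCov (T v)) + ENNReal.ofReal c := by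
      filter_upwards [ae_det_gram_ne_zero (E := EuclideanSpace ℝ (Fin n)) (m := m + 1)
        (by omega)] with v hv
      have hM : (sampleCov (T v)).PosDef := by
        rw [posDef_sampleCov_iff_det_ne_zero, hdet]
        have := hS.det_pos.ne'
        have := hn'.ne'
        positivity
      have hG := (posDef_gram_of_det_ne_zero hv).inv
      have h1 := le_steinLoss hS hM
      rw [htr v hv] at h1
      have h2 : (Matrix.gram ℝ v)⁻¹ 0 0 ≤ ((Matrix.gram ℝ v)⁻¹).trace :=
        Finset.single_le_sum (f := fun k => (Matrix.gram ℝ v)⁻¹ k k)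
          (fun k _ => hG.posSemidef.diag_nonneg) (Finset.mem_univ 0)
      rw [gaussianCovKL_eq_ofReal hS hM, ← ENNReal.ofReal_mul (by positivity),
        ← ENNReal.ofReal_add (steinLoss_nonneg hS hM) (by positivity)]
      refine ENNReal.ofReal_le_ofReal ?_
      have h3 := mul_le_mul_of_nonneg_left h2 hn'.le
      linarith
    have hint := lintegral_mono_ae hle
    rw [lintegral_const_mul' _ _ ENNReal.ofReal_ne_top, htop,
      ENNReal.mul_top (by simpa using hn'),
      lintegral_add_right _ measurable_const, lintegral_const, measure_univ, mul_one,
      top_le_iff, ENNReal.add_eq_top] at hint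
    exact hint.resolve_right ENNReal.ofReal_ne_top

/-- The mean trace of an inverse Wishart matrix: every diagonal entry is an inverse chi-squared
variable with `n - d + 1` degrees of freedom. -/
lemma integrable_and_integral_trace_inv_gram (hdn : d + 1 < n) :
    Integrable (fun v : Fin d → EuclideanSpace ℝ (Fin n) => ((Matrix.gram ℝ v)⁻¹).trace)
      (Measure.pi fun _ => stdGaussian (EuclideanSpace ℝ (Fin n))) ∧
    ∫ v : Fin d → EuclideanSpace ℝ (Fin n), ((Matrix.gram ℝ v)⁻¹).trace
      ∂(Measure.pi fun _ => stdGaussian (EuclideanSpace ℝ (Fin n))) =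
      d / ((n : ℝ) - d - 1) := by
  obtain _ | m := d
  · simp [Matrix.trace]
  have hdn' : (m : ℝ) + 1 + 1 < n := by exact_mod_cast hdn
  have hpos : 0 ≤ 1 / ((n : ℝ) - m - 2) := one_div_nonneg.mpr (by linarith)
  have hnn : ∀ k : Fin (m + 1),
      0 ≤ᵐ[Measure.pi fun _ : Fin (m + 1) => stdGaussian (EuclideanSpace ℝ (Fin n))]
        fun v => (Matrix.gram ℝ v)⁻¹ k k := by
    intro k
    filter_upwards [ae_det_gram_ne_zero (E := EuclideanSpace ℝ (Fin n)) (m := m + 1)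
      (by rw [finrank_euclideanSpace_fin]; omega)] with v hv
    exact (posDef_gram_of_det_ne_zero hv).inv.posSemidef.diag_nonneg
  have hmeas : ∀ k : Fin (m + 1), Measurable
      fun v : Fin (m + 1) → EuclideanSpace ℝ (Fin n) => (Matrix.gram ℝ v)⁻¹ k k := by
    intro k
    simp_rw [inv_gram_apply_self]
    exact (measurable_gramRatio k).inv
  have hval : ∀ k : Fin (m + 1), ∫⁻ v, ENNReal.ofReal ((Matrix.gram ℝ v)⁻¹ k k)
      ∂(Measure.pi fun _ : Fin (m + 1) => stdGaussian (EuclideanSpace ℝ (Fin n))) =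
      ENNReal.ofReal (1 / ((n : ℝ) - m - 2)) := by
    intro k
    rw [lintegral_inv_gram_apply_self (by rw [finrank_euclideanSpace_fin]; omega),
      finrank_euclideanSpace_fin]
  have hint : ∀ k : Fin (m + 1), Integrable
      (fun v : Fin (m + 1) → EuclideanSpace ℝ (Fin n) => (Matrix.gram ℝ v)⁻¹ k k)
      (Measure.pi fun _ => stdGaussian (EuclideanSpace ℝ (Fin n))) := fun k =>
    ⟨(hmeas k).aestronglyMeasurable, by
      rw [hasFiniteIntegral_iff_ofReal (hnn k), hval]; exact ENNReal.ofReal_lt_top⟩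
  simp only [Matrix.trace, Matrix.diag]
  refine ⟨integrable_finsetSum _ fun k _ => hint k, ?_⟩
  rw [integral_finsetSum _ fun k _ => hint k]
  have : ∀ k : Fin (m + 1), ∫ v : Fin (m + 1) → EuclideanSpace ℝ (Fin n), (Matrix.gram ℝ v)⁻¹ k k
      ∂(Measure.pi fun _ => stdGaussian (EuclideanSpace ℝ (Fin n))) =
      1 / ((n : ℝ) - m - 2) := by
    intro k
    rw [integral_eq_lintegral_of_nonneg_ae (hnn k) (hmeas k).aestronglyMeasurable, hval,
      ENNReal.toReal_ofReal hpos]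
  simp only [this, Finset.sum_const, Finset.card_univ, Fintype.card_fin, nsmul_eq_mul]
  rw [mul_one_div]
  push_cast
  congr 1
  ring

/-- In terms of the Gram matrix `G` of `d` independent standard Gaussian rows, the divergence is
`(n tr G⁻¹ + log det G - d - d log n) / 2`, and both random terms have known means. -/
lemma lintegral_gaussianCovKL_sampleCov_ne_top_and_toReal (hdn : d + 1 < n) (hS : S.PosDef) :
    ∫⁻ x, gaussianCovKL S (sampleCov x)
      ∂(Measure.pi fun _ : Fin n => multivariateGaussian (0 : EuclideanSpace ℝ (Fin d)) S) ≠ ∞ ∧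
    (∫⁻ x, gaussianCovKL S (sampleCov x)
      ∂(Measure.pi fun _ : Fin n =>
        multivariateGaussian (0 : EuclideanSpace ℝ (Fin d)) S)).toReal =
      d * (d + 1) / 2 / ((n : ℝ) - d - 1) +
        (multivariateDigamma d (n / 2) - d * log (n / 2)) / 2 := by
  have hn : n ≠ 0 := by omega
  have hn' : (0 : ℝ) < n := by exact_mod_cast Nat.pos_of_ne_zero hn
  have hSdet := hS.det_pos
  obtain ⟨T, hT, hdet, htr⟩ := exists_measurePreserving_sampleCov hn hS
  rw [← hT.lintegral_comp (measurable_gaussianCovKL_sampleCov hS)]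
  set Q := Measure.pi fun _ : Fin d => stdGaussian (EuclideanSpace ℝ (Fin n)) with hQ
  have hdn2 : d ≤ finrank ℝ (EuclideanSpace ℝ (Fin n)) := by
    rw [finrank_euclideanSpace_fin]; omega
  obtain ⟨i1, e1⟩ := integrable_and_integral_trace_inv_gram hdn
  obtain ⟨i2, e2⟩ := integrable_and_integral_log_det_gram hdn2
  rw [finrank_euclideanSpace_fin] at e2
  let f : (Fin d → EuclideanSpace ℝ (Fin n)) → ℝ := fun v =>
    (n * ((Matrix.gram ℝ v)⁻¹).trace + log (Matrix.gram ℝ v).det - (d + d * log n)) / 2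
  have hae : ∀ᵐ v ∂Q, gaussianCovKL S (sampleCov (T v)) = ENNReal.ofReal (f v) ∧ 0 ≤ f v := by
    filter_upwards [ae_det_gram_ne_zero hdn2] with v hv
    have hM : (sampleCov (T v)).PosDef := by
      rw [posDef_sampleCov_iff_det_ne_zero, hdet]
      positivity
    have hf : steinLoss S (sampleCov (T v)) = f v := by
      rw [steinLoss, htr v hv, hdet, Real.log_mul (by positivity) hv,
        Real.log_mul (by positivity) hSdet.ne', Real.log_pow, Real.log_inv]
      simp only [f]
      ring
    rw [gaussianCovKL_eq_ofReal hS hM, hf]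
    exact ⟨rfl, hf ▸ steinLoss_nonneg hS hM⟩
  have hfint : Integrable f Q :=
    (((i1.const_mul (n : ℝ)).add i2).sub (integrable_const _)).div_const 2
  have hval : ∫ v, f v ∂Q = d * (d + 1) / 2 / ((n : ℝ) - d - 1) +
      (multivariateDigamma d (n / 2) - d * log (n / 2)) / 2 := by
    have hdn' : (d : ℝ) + 1 < n := by exact_mod_cast hdn
    have hne : (n : ℝ) - d - 1 ≠ 0 := by linarith
    simp only [f]
    have i3 : Integrable (fun v : Fin d → EuclideanSpace ℝ (Fin n) =>
        n * ((Matrix.gram ℝ v)⁻¹).trace + log (Matrix.gram ℝ v).det) Q :=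
      (i1.const_mul (n : ℝ)).add i2
    rw [integral_div, integral_sub i3 (integrable_const _),
      integral_add (i1.const_mul (n : ℝ)) i2, integral_const_mul, e1, e2, integral_const,
      probReal_univ, one_smul, Real.log_div hn'.ne' two_ne_zero]
    field_simp
    ring
  rw [lintegral_congr_ae (hae.mono fun v hv => hv.1),
    ← ofReal_integral_eq_lintegral_ofReal hfint (hae.mono fun v hv => hv.2)]
  refine ⟨ENNReal.ofReal_ne_top, ?_⟩
  rw [ENNReal.toReal_ofReal (integral_nonneg_of_ae (hae.mono fun v hv => hv.2)), hval]

/-- Each summand satisfies `ψ((n - i) / 2) - log (n / 2) ≤ -(i + 1) / n`. -/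
lemma multivariateDigamma_sub_le (hdn : d ≤ n) :
    multivariateDigamma d ((n : ℝ) / 2) - d * log (n / 2) ≤ -(d * (d + 1) / 2 / n) := by
  induction d with
  | zero => simp [multivariateDigamma]
  | succ d ih =>
    have ih := ih (Nat.le_of_succ_le hdn)
    have hlt : (d : ℝ) < n := by exact_mod_cast hdn
    have hd0 : (0 : ℝ) ≤ d := d.cast_nonneg
    have hn0 : (0 : ℝ) < n := by linarith
    have hx : 0 < (n : ℝ) / 2 - d / 2 := by linarith
    have h1 := digamma_re_le_log_sub hx
    have h2 : log ((n : ℝ) / 2 - d / 2) - log (n / 2) ≤ -(d / n) := by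
      rw [← Real.log_div hx.ne' (by positivity)]
      refine (Real.log_le_sub_one_of_pos (by positivity)).trans (le_of_eq ?_)
      field_simp
      ring
    have h3 : 1 / (n : ℝ) ≤ 1 / (2 * ((n : ℝ) / 2 - d / 2)) :=
      one_div_le_one_div_of_le (by linarith) (by linarith)
    have h4 : -((d + 1 : ℕ) * ((d + 1 : ℕ) + 1) / 2 / (n : ℝ)) =
        -(d * (d + 1) / 2 / (n : ℝ)) + -(d / n) - 1 / n := by
      push_cast
      field_simp
      ring
    rw [h4]
    rw [multivariateDigamma] at ih ⊢
    rw [Finset.sum_range_succ]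
    rw [Nat.cast_succ]
    linarith

end Expectation

end

theorem mainTheorem5 {Ω : Type*} [MeasurableSpace Ω] (P : Measure Ω) [IsProbabilityMeasure P]
    (d n : ℕ) (hd : 1 ≤ d) (hn : 1 ≤ n)
    (S : Matrix (Fin d) (Fin d) ℝ) (hS : S.PosDef)
    (X : Fin n → Ω → EuclideanSpace ℝ (Fin d))
    (hlaw : ∀ i, HasLaw (X i) (multivariateGaussian 0 S) P)
    (hindep : iIndepFun X P)
    (p : ℝ) (hp : p = (d : ℝ) * ((d : ℝ) + 1) / 2) :
    -- the sample covariance is the unique maximum likelihood estimate, and the divergence is the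
    -- Bregman divergence of the entropy
    (d ≤ n → ∀ᵐ ω ∂P,
      (∀ M, IsGaussianCovMLE (fun i => X i ω) M ↔ M = sampleCov (fun i => X i ω)) ∧
      gaussianCovKL S (sampleCov (fun i => X i ω)) ≠ ∞ ∧
      (gaussianCovKL S (sampleCov (fun i => X i ω))).toReal =
        bregmanDivergence gaussianCovEntropy S (sampleCov (fun i => X i ω))) ∧
    AEMeasurable (fun ω => gaussianCovKL S (sampleCov (fun i => X i ω))) P ∧
    (n ≤ d + 1 → ∫⁻ ω, gaussianCovKL S (sampleCov (fun i => X i ω)) ∂P = ∞) ∧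
    (d + 1 < n →
      ∫⁻ ω, gaussianCovKL S (sampleCov (fun i => X i ω)) ∂P ≠ ∞ ∧
      (∫⁻ ω, gaussianCovKL S (sampleCov (fun i => X i ω)) ∂P).toReal =
        p / ((n : ℝ) - d - 1) +
          (multivariateDigamma d ((n : ℝ) / 2) - d * Real.log ((n : ℝ) / 2)) / 2 ∧
      (∫⁻ ω, gaussianCovKL S (sampleCov (fun i => X i ω)) ∂P).toReal ≤
        p / (2 * n) + p * (d + 2) / (n * ((n : ℝ) - d - 1))) := by
  have hn0 : n ≠ 0 := by omega
  have hX : ∀ i, AEMeasurable (X i) P := fun i => (hlaw i).aemeasurable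
  have hXm : AEMeasurable (fun ω i => X i ω) P := aemeasurable_pi_lambda _ hX
  have hmap : P.map (fun ω i => X i ω) = Measure.pi fun _ => multivariateGaussian 0 S := by
    rw [(iIndepFun_iff_map_fun_eq_pi_map hX).mp hindep]
    simp_rw [fun i => (hlaw i).map_eq]
  have hKL := measurable_gaussianCovKL_sampleCov (n := n) hS
  have hlint : ∫⁻ ω, gaussianCovKL S (sampleCov (fun i => X i ω)) ∂P =
      ∫⁻ x, gaussianCovKL S (sampleCov x)
        ∂(Measure.pi fun _ : Fin n => multivariateGaussian (0 : EuclideanSpace ℝ (Fin d)) S) := by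
    rw [← hmap, lintegral_map' hKL.aemeasurable hXm]
  rw [hlint]
  refine ⟨fun hdn => ?_, hKL.comp_aemeasurable hXm,
    fun hdn => lintegral_gaussianCovKL_sampleCov_eq_top hd hn0 hdn hS, fun hdn => ?_⟩
  · have hpd := ae_posDef_sampleCov hn0 hdn hS
    rw [← hmap] at hpd
    filter_upwards [ae_of_ae_map hXm hpd] with ω hω
    obtain ⟨h1, h2⟩ := gaussianCovKL_ne_top_and_toReal hS hω
    exact ⟨isGaussianCovMLE_iff_eq_sampleCov hn0 _ hω, h1,
      h2.trans (bregmanDivergence_gaussianCovEntropy hS hω).symm⟩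
  · obtain ⟨h1, h2⟩ := lintegral_gaussianCovKL_sampleCov_ne_top_and_toReal hdn hS
    refine ⟨h1, by rw [h2, hp], ?_⟩
    have hdn' : (d : ℝ) + 1 < n := by exact_mod_cast hdn
    have hd0 : (0 : ℝ) ≤ d := d.cast_nonneg
    have hn1 : (0 : ℝ) < n := by linarith
    have hk : 0 < (n : ℝ) - d - 1 := by linarith
    have hp0 : 0 ≤ p := by rw [hp]; positivity
    have h3 := multivariateDigamma_sub_le (d := d) (n := n) (by omega)
    rw [h2]
    rw [← hp] at h3 ⊢
    calc p / ((n : ℝ) - d - 1) + (multivariateDigamma d (n / 2) - d * Real.log (n / 2)) / 2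
        ≤ p / ((n : ℝ) - d - 1) + -(p / n) / 2 := by gcongr
      _ = p / (2 * n) + p * (d + 1) / (n * ((n : ℝ) - d - 1)) := by field_simp; ring
      _ ≤ p / (2 * n) + p * (d + 2) / (n * ((n : ℝ) - d - 1)) := by gcongr; norm_num
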